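/- Conventions. Let $\|\cdot\|$ be the Euclidean norm on $\mathbb R^{d_0}$ and the associated operator norm on matrices, and let $G$ be a subgroup of $GL(d_0,\mathbb R)$. A periodic cocycle in $G$ with period $\ell\ge 1$ is a sequence $A=(A_i)_{i\in\mathbb Z}$ in $G$ with $A_{i+\ell}=A_i$ for all $i$ (the period $\ell$ need not be minimal). It is hyperbolic if $\mathcal A:=A_\ell\cdots A_1$ has no complex eigenvalue of modulus $1$, and it is bounded by $C$ if $\max(\|A_i\|,\|A_i^{-1}\|)\le C$ for $1\le i\le \ell$. For a hyperbolic cocycle, the stable space $E^s_j$ (resp. the unstable space $E^u_j$) at index $j$ is the sum of the real generalized eigenspaces of $A_{j+\ell-1}\cdots A_j$ associated with the eigenvalues of modulus $<1$ (resp. $>1$), so that $\mathbb R^{d_0}=E^s_j\oplus E^u_j$ and $A_jE^{*}_j=E^{*}_{j+1}$. This splitting is $N$-dominated if, for all $i\in\mathbb Z$, all $n\ge N$ and all unit vectors $u\in E^s_i$, $v\in E^u_i$, $$\|A_{i+n-1}\cdots A_i\,u\|\le \tfrac12\|A_{i+n-1}\cdots A_i\,v\|.$$ An $\varepsilon$-path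 of perturbations of $A$ in $G$ with period $\ell$ is a family $(A_i(t))_{i\in\mathbb Z}$, $t\in[0,1]$, of periodic cocycles in $G$ with period $\ell$, continuous in $t$, such that $A_i(0)=A_i$ and $\max(\|A_i-A_i(t)\|,\|A_i^{-1}-A_i(t)^{-1}\|)<\varepsilon$ for all $i$ and $t$. The angle between two subspaces is the infimum of the angles between their nonzero vectors ($+\infty$ if one of them is zero). When $d_0=2d$ is even, $Sp(d_0,\mathbb R)$ is the group of matrices preserving the standard symplectic form on $\mathbb R^{2d}$. Theorem (Small angle). For any integer $d_0\ge1$ and any real numbers $C>1$, $\varepsilon>0$, there exist integers $T,N\ge1$ with the following property. Let $G$ be $GL(d_0,\mathbb R)$, $SL(d_0,\mathbb R)$ or, if $d_0$ is even, $Sp(d_0,\mathbb R)$. For any hyperbolic periodic cocycle $(A_i)_{i\in\mathbb Z}$ in $G$, bounded by $C$, with period $\ell\ge T$ and such that its splitting into stable and unstable spaces is not $N$-dominated, there exists an $\varepsilon$-path of perturbations $(A_i(t))_{t\in[0,1]}$ in $G$ with period $\ell$ such that: - $\mathcal A(t):=A_\ell(t)\cdots A_1(t)$ is hyperbolic for each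 $t\in[0,1]$; - for some $j\in\{1,\dots,\ell\}$, the angle between the stable and unstable spaces $E^s_j$, $E^u_j$ of the cocycle $(A_i(1))$ is smaller than $\varepsilon$. -/

import Mathlib

open scoped unitInterval

noncomputable section

namespace LinearCocycle

/-- `SL(d, ℝ)` as a subgroup of `GL(d, ℝ)`: the matrices of determinant `1`. -/
def specialLinear (ι : Type) [Fintype ι] [DecidableEq ι] : Subgroup (GL ι ℝ) :=
  (Matrix.GeneralLinearGroup.det : GL ι ℝ →* ℝˣ).ker

/-- `Sp(2d, ℝ)` as a subgroup of `GL(2d, ℝ)`: the matrices preserving the standard symplectic form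
of `ℝ^d × ℝ^d`. -/
def symplectic (d : ℕ) : Subgroup (GL (Fin d ⊕ Fin d) ℝ) where
  carrier := {g | (g : Matrix (Fin d ⊕ Fin d) (Fin d ⊕ Fin d) ℝ) ∈ Matrix.symplecticGroup (Fin d) ℝ}
  one_mem' := by
    simp
  mul_mem' := by
    intro a b ha hb
    simpa using (Matrix.symplecticGroup (Fin d) ℝ).mul_mem ha hb
  inv_mem' := by
    intro g hg
    have h1 := SymplecticGroup.mem_iff.mp hg
    have h2 : ((g⁻¹ : GL (Fin d ⊕ Fin d) ℝ) : Matrix (Fin d ⊕ Fin d) (Fin d ⊕ Fin d) ℝ) *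
        (g : Matrix (Fin d ⊕ Fin d) (Fin d ⊕ Fin d) ℝ) = 1 := g.inv_mul
    have h3 := congrArg Matrix.transpose h2
    rw [Matrix.transpose_mul, Matrix.transpose_one] at h3
    refine SymplecticGroup.mem_iff.mpr ?_
    rw [← h1]
    simp only [Matrix.mul_assoc]
    rw [h3, Matrix.mul_one, ← Matrix.mul_assoc, h2, Matrix.one_mul, ← Matrix.mul_assoc, h1]

variable {ι : Type} [Fintype ι] [DecidableEq ι]

/-- The linear action of `g ∈ GL(d, ℝ)` on Euclidean space; `‖act g‖` is the operator norm of `g`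
for the Euclidean norm. -/
def act (g : GL ι ℝ) : EuclideanSpace ℝ ι →L[ℝ] EuclideanSpace ℝ ι :=
  Matrix.toEuclideanCLM (𝕜 := ℝ) (g : Matrix ι ι ℝ)

/-- The complex-linear extension of `g ∈ GL(d, ℝ)` to `ℂ^d`. -/
def complexify (g : GL ι ℝ) : Module.End ℂ (ι → ℂ) :=
  Matrix.toLin' ((g : Matrix ι ι ℝ).map Complex.ofReal)

/-- The inclusion of `ℝ^d` into `ℂ^d`. -/
def toComplex : EuclideanSpace ℝ ι →ₗ[ℝ] (ι → ℂ) where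
  toFun v i := (v i : ℂ)
  map_add' u v := by ext i; simp
  map_smul' c v := by ext i; simp

/-- The real invariant subspace of `g` associated with the eigenvalues lying in `S`: the real
vectors in the sum of the complex generalized eigenspaces of `g` for the eigenvalues in `S`. -/
def spectralSubspace (g : GL ι ℝ) (S : Set ℂ) : Submodule ℝ (EuclideanSpace ℝ ι) :=
  ((⨆ z ∈ S, (complexify g).maxGenEigenspace z).restrictScalars ℝ).comap toComplex

/-- The angle between two subspaces: the infimum of the angles between nonzero vectors of the one
and nonzero vectors of the other (infinite if one of the subspaces is zero). -/
def subspaceAngle (E F : Submodule ℝ (EuclideanSpace ℝ ι)) : ENNReal :=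
  ⨅ (u ∈ E) (v ∈ F) (_ : u ≠ 0) (_ : v ≠ 0), ENNReal.ofReal (InnerProductGeometry.angle u v)

/-- A periodic cocycle with period `ℓ ≥ 1` in a subgroup `G` of `GL(d, ℝ)`. The period is not
required to be minimal. -/
structure PeriodicCocycle (G : Subgroup (GL ι ℝ)) (ℓ : ℕ) where
  toFun : ℤ → GL ι ℝ
  mem : ∀ i, toFun i ∈ G
  one_le_period : 1 ≤ ℓ
  periodic : ∀ i, toFun (i + ℓ) = toFun i

namespace PeriodicCocycle

variable {G : Subgroup (GL ι ℝ)} {ℓ : ℕ}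

/-- `A.prod i n = A_{i+n-1} ⋯ A_{i+1} A_i`: the product of `n` successive terms, from index `i`. -/
def prod (A : PeriodicCocycle G ℓ) (i : ℤ) : ℕ → GL ι ℝ
  | 0 => 1
  | n + 1 => A.toFun (i + n) * A.prod i n

/-- The product over one period, `A_ℓ ⋯ A_1`. -/
def periodProd (A : PeriodicCocycle G ℓ) : GL ι ℝ := A.prod 1 ℓ

/-- The product over one period has no (complex) eigenvalue on the unit circle. -/
def Hyperbolic (A : PeriodicCocycle G ℓ) : Prop :=
  ∀ z : ℂ, (complexify A.periodProd).HasEigenvalue z → ‖z‖ ≠ 1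

/-- The cocycle is bounded by `C`. -/
def BoundedBy (A : PeriodicCocycle G ℓ) (C : ℝ) : Prop :=
  ∀ i : ℤ, 1 ≤ i → i ≤ ℓ → max ‖act (A.toFun i)‖ ‖act ((A.toFun i)⁻¹)‖ ≤ C

/-- The stable space at index `j`: it is the stable space of `A_{j+ℓ-1} ⋯ A_j`. -/
def stableSpace (A : PeriodicCocycle G ℓ) (j : ℤ) : Submodule ℝ (EuclideanSpace ℝ ι) :=
  spectralSubspace (A.prod j ℓ) {z | ‖z‖ < 1}

/-- The unstable space at index `j`: it is the unstable space of `A_{j+ℓ-1} ⋯ A_j`. -/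
def unstableSpace (A : PeriodicCocycle G ℓ) (j : ℤ) : Submodule ℝ (EuclideanSpace ℝ ι) :=
  spectralSubspace (A.prod j ℓ) {z | 1 < ‖z‖}

/-- The splitting into the bundles `E` and `F` is `N`-dominated: at every index and for all `n ≥ N`,
the iterate of order `n` expands the unit vectors of `F` at least twice as much as those of `E`. -/
def IsDominated (A : PeriodicCocycle G ℓ) (E F : ℤ → Submodule ℝ (EuclideanSpace ℝ ι)) (N : ℕ) :
    Prop :=
  ∀ (i : ℤ) (n : ℕ), N ≤ n → ∀ u ∈ E i, ∀ v ∈ F i, ‖u‖ = 1 → ‖v‖ = 1 →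
    ‖act (A.prod i n) u‖ ≤ ‖act (A.prod i n) v‖ / 2

/-- `B` is an `ε`-path of perturbations of `A`, in the same group and with the same period. -/
structure IsPathOfPerturbations (A : PeriodicCocycle G ℓ) (ε : ℝ) (B : I → PeriodicCocycle G ℓ) :
    Prop where
  continuous : ∀ i, Continuous fun t => (B t).toFun i
  zero : ∀ i, (B 0).toFun i = A.toFun i
  close : ∀ t i, max ‖act (A.toFun i) - act ((B t).toFun i)‖
    ‖act ((A.toFun i)⁻¹) - act (((B t).toFun i)⁻¹)‖ < ε

end PeriodicCocycle

/-- Every hyperbolic periodic cocycle in `G`, bounded by `C`, of period `ℓ ≥ T`, whose splitting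
into stable and unstable spaces is not `N`-dominated, has an `ε`-path of perturbations with period
`ℓ` that consists of hyperbolic cocycles and ends at a cocycle for which, at some index
`j ∈ {1, …, ℓ}`, the angle between the stable and the unstable space is smaller than `ε`. -/
def SmallAngleProperty (G : Subgroup (GL ι ℝ)) (C ε : ℝ) (T N : ℕ) : Prop :=
  ∀ (ℓ : ℕ) (A : PeriodicCocycle G ℓ), T ≤ ℓ → A.Hyperbolic → A.BoundedBy C →
    ¬ A.IsDominated A.stableSpace A.unstableSpace N →
    ∃ B : I → PeriodicCocycle G ℓ, A.IsPathOfPerturbations ε B ∧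
      (∀ t, (B t).Hyperbolic) ∧
      ∃ j : ℤ, 1 ≤ j ∧ j ≤ ℓ ∧
        subspaceAngle ((B 1).stableSpace j) ((B 1).unstableSpace j) < ENNReal.ofReal ε

end LinearCocycle

end

/-! If the initial angle is already small, the constant path works. Otherwise the angle is bounded
below by a constant κ, and the perturbation is a change of coordinates that tilts the stable spaces
towards the unstable ones. Let `X k` be an equivariant family of matrices with image in E^u and zero
on E^u. Then X² = 0, and H_k = 1 + t a_k X_k fixes E^u pointwise. Conjugating by a periodic family H
keeps the period product in its conjugacy class, so hyperbolicity is automatic along the path. By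
equivariance, H_{k+1} A_k H_k⁻¹ = (1 + t(a_{k+1} − a_k) X_{k+1}) A_k. The cost is therefore |a_{k+1}
− a_k| ‖X_{k+1}‖, while the gain at an index c is |a_c| ‖X_c‖: once this is large, some vector x +
a_c X_c x of the new stable space is almost parallel to E^u.

It remains to find scalars a, supported on an interval shorter than the period, with small cost
everywhere and a prescribed gain at one point (`exists_cutoff`). Put b_k = ‖X_k‖. The sums S_k of
1/b_j over k < j ≤ e have increments of cost 1. If b_k S_k never became large, S would grow
exponentially backwards, forcing b_k to drop sharply over a long interval. So it suffices that b not
grow much over one long interval, and this is what failure of domination provides. In GL and SL, X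
is a rank-one map sending the stable vector to the unstable one
(`exists_isShearFamily_of_transvections`). In Sp, X is a symplectic transvection along an unstable
vector of controlled growth, found by duality between the two Lagrangian spaces
(`exists_isShearFamily_of_symplectic`). All constants depend only on C, ε and these bounds, hence T
and N are uniform. -/

noncomputable section

namespace LinearCocycle

/-! ### Spectral subspaces: equivariance, asymptotics of iterates, and spanning -/

section Spectral

open Filter Topology Module.End

variable {ι : Type} [Fintype ι] [DecidableEq ι]

theorem act_mul (g h : GL ι ℝ) : act (g * h) = act g * act h := by
  simp [act]

theorem act_one : act (1 : GL ι ℝ) = 1 := by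
  simp [act]

theorem act_mul_apply (g h : GL ι ℝ) (v : EuclideanSpace ℝ ι) :
    act (g * h) v = act g (act h v) := by
  rw [act_mul]; rfl

theorem act_one_apply (v : EuclideanSpace ℝ ι) : act (1 : GL ι ℝ) v = v := by
  rw [act_one]; rfl

theorem act_inv_act (g : GL ι ℝ) (v : EuclideanSpace ℝ ι) : act g⁻¹ (act g v) = v := by
  rw [← act_mul_apply, inv_mul_cancel, act_one_apply]

theorem act_act_inv (g : GL ι ℝ) (v : EuclideanSpace ℝ ι) : act g (act g⁻¹ v) = v := by
  rw [← act_mul_apply, mul_inv_cancel, act_one_apply]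

theorem complexify_mul (g h : GL ι ℝ) : complexify (g * h) = complexify g * complexify h := by
  have : ((g * h : GL ι ℝ) : Matrix ι ι ℝ).map Complex.ofReal =
      (g : Matrix ι ι ℝ).map Complex.ofReal * (h : Matrix ι ι ℝ).map Complex.ofReal := by
    rw [Units.val_mul]
    exact Matrix.map_mul (f := Complex.ofRealHom)
  simp only [complexify, this, Matrix.toLin'_mul]
  rfl

theorem complexify_one : complexify (1 : GL ι ℝ) = 1 := by
  simp [complexify, Module.End.one_eq_id]

theorem complexify_toComplex (g : GL ι ℝ) (v : EuclideanSpace ℝ ι) :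
    complexify g (toComplex v) = toComplex (act g v) := by
  ext i
  simp [complexify, toComplex, act, Matrix.mulVec, dotProduct]

/-- Coordinatewise complex conjugation on `ℂ^d`. -/
def conjVec (x : ι → ℂ) : ι → ℂ := fun i => (starRingEnd ℂ) (x i)

theorem complexify_conjVec (g : GL ι ℝ) (x : ι → ℂ) :
    complexify g (conjVec x) = conjVec (complexify g x) := by
  ext i
  simp [complexify, conjVec, Matrix.mulVec, dotProduct]


theorem mem_maxGenEigenspace_of_semiconj {V : Type*} [AddCommGroup V] [Module ℂ V]
    {e f f' : Module.End ℂ V} (h : SemiconjBy e f f') {z : ℂ} {x : V}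
    (hx : x ∈ maxGenEigenspace f z) : e x ∈ maxGenEigenspace f' z := by
  rw [mem_maxGenEigenspace] at hx ⊢
  obtain ⟨k, hk⟩ := hx
  have h1 : SemiconjBy e (f - z • 1) (f' - z • 1) := by
    refine h.sub_right ?_
    simp [SemiconjBy]
  have h2 := congrArg (fun T : Module.End ℂ V => T x) (h1.pow_right k).eq
  simp only [Module.End.mul_apply, hk, map_zero] at h2
  exact ⟨k, h2.symm⟩

theorem conjVec_mem_maxGenEigenspace (g : GL ι ℝ) {z : ℂ} {x : ι → ℂ}
    (hx : x ∈ maxGenEigenspace (complexify g) z) :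
    conjVec x ∈ maxGenEigenspace (complexify g) ((starRingEnd ℂ) z) := by
  rw [mem_maxGenEigenspace] at hx ⊢
  obtain ⟨k, hk⟩ := hx
  have key : ∀ (k : ℕ) (y : ι → ℂ), ((complexify g - (starRingEnd ℂ) z • 1) ^ k) (conjVec y) =
      conjVec (((complexify g - z • 1) ^ k) y) := by
    intro k
    induction k with
    | zero => intro y; simp
    | succ k ih =>
      intro y
      rw [pow_succ, pow_succ, Module.End.mul_apply, Module.End.mul_apply, ← ih]
      congr 1
      simp only [LinearMap.sub_apply, complexify_conjVec]
      ext i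
      simp [conjVec]
  refine ⟨k, ?_⟩
  rw [key, hk]
  ext i
  simp [conjVec]

theorem mem_spectralSubspace {g : GL ι ℝ} {S : Set ℂ} {v : EuclideanSpace ℝ ι} :
    v ∈ spectralSubspace g S ↔
      toComplex v ∈ ⨆ z ∈ S, (complexify g).maxGenEigenspace z := Iff.rfl

theorem act_mem_spectralSubspace {g g' h : GL ι ℝ} (hh : h * g = g' * h) {S : Set ℂ}
    {v : EuclideanSpace ℝ ι} (hv : v ∈ spectralSubspace g S) :
    act h v ∈ spectralSubspace g' S := by
  rw [mem_spectralSubspace] at hv ⊢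
  rw [← complexify_toComplex]
  have hs : SemiconjBy (complexify h) (complexify g) (complexify g') := by
    rw [SemiconjBy, ← complexify_mul, hh, complexify_mul]
  have hle : (⨆ z ∈ S, (complexify g).maxGenEigenspace z) ≤
      (⨆ z ∈ S, (complexify g').maxGenEigenspace z).comap (complexify h) :=
    iSup₂_le fun z hz x hx =>
      (le_iSup₂ (f := fun z (_ : z ∈ S) => (complexify g').maxGenEigenspace z) z hz)
        (mem_maxGenEigenspace_of_semiconj hs hx)
  exact hle hv

theorem hasEigenvalue_of_conj {g g' h : GL ι ℝ} (hh : h * g = g' * h) {z : ℂ}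
    (hz : (complexify g).HasEigenvalue z) : (complexify g').HasEigenvalue z := by
  obtain ⟨x, hx⟩ := hz.exists_hasEigenvector
  refine hasEigenvalue_of_hasEigenvector (x := complexify h x) ⟨?_, ?_⟩
  · rw [mem_eigenspace_iff, ← Module.End.mul_apply, ← complexify_mul, ← hh, complexify_mul,
      Module.End.mul_apply, hx.apply_eq_smul, map_smul]
  · intro h0
    apply hx.2
    have : (complexify h⁻¹ * complexify h) x = 0 := by
      rw [Module.End.mul_apply, h0, map_zero]
    rwa [← complexify_mul, inv_mul_cancel, complexify_one, Module.End.one_apply] at this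

/-- Used by induction on the order k of a generalized eigenvector x: the orbit of x obeys this
recursion, with forcing term given by the orbit of (f − z)x, which has order k − 1. -/
theorem tendsto_zero_of_recursion {V : Type*} [NormedAddCommGroup V] [NormedSpace ℂ V]
    {z : ℂ} (hz : ‖z‖ < 1) {a y : ℕ → V} (hy : Tendsto y atTop (𝓝 0))
    (h : ∀ p, a (p + 1) = z • a p + y p) : Tendsto a atTop (𝓝 0) := by
  rw [Metric.tendsto_atTop]
  intro ε hε
  have h1 : 0 < 1 - ‖z‖ := by linarith
  obtain ⟨P, hP⟩ := Metric.tendsto_atTop.mp hy ((1 - ‖z‖) * (ε / 2)) (by positivity)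
  have hb : ∀ q, ‖a (P + q)‖ ≤ ‖z‖ ^ q * ‖a P‖ + ε / 2 := by
    intro q
    induction q with
    | zero => simp; positivity
    | succ q ih =>
      have h2 := hP (P + q) (by omega)
      rw [dist_zero_right] at h2
      rw [← add_assoc, h, pow_succ]
      calc ‖z • a (P + q) + y (P + q)‖ ≤ ‖z‖ * ‖a (P + q)‖ + ‖y (P + q)‖ := by
            rw [← norm_smul]; exact norm_add_le _ _
        _ ≤ ‖z‖ * (‖z‖ ^ q * ‖a P‖ + ε / 2) + (1 - ‖z‖) * (ε / 2) := by gcongr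
        _ = _ := by ring
  have ht : Tendsto (fun q => ‖z‖ ^ q * ‖a P‖) atTop (𝓝 0) := by
    simpa using (tendsto_pow_atTop_nhds_zero_of_lt_one (norm_nonneg z) hz).mul_const ‖a P‖
  obtain ⟨Q, hQ⟩ := Filter.eventually_atTop.mp (ht.eventually (gt_mem_nhds (half_pos hε)))
  refine ⟨P + Q, fun n hn => ?_⟩
  obtain ⟨q, rfl⟩ := Nat.exists_eq_add_of_le (show P ≤ n by omega)
  have h3 := hQ q (by omega)
  have h4 := hb q
  rw [dist_zero_right]
  linarith

theorem tendsto_pow_apply_of_mem_maxGenEigenspace {V : Type*} [NormedAddCommGroup V]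
    [NormedSpace ℂ V] (f : Module.End ℂ V) {z : ℂ} (hz : ‖z‖ < 1) {x : V}
    (hx : x ∈ maxGenEigenspace f z) : Tendsto (fun p => (f ^ p) x) atTop (𝓝 0) := by
  rw [mem_maxGenEigenspace] at hx
  obtain ⟨k, hk⟩ := hx
  induction k generalizing x with
  | zero => simp only [pow_zero, Module.End.one_apply] at hk; simp [hk]
  | succ k ih =>
    rw [pow_succ, Module.End.mul_apply] at hk
    refine tendsto_zero_of_recursion hz (ih hk) fun p => ?_
    rw [← map_smul, ← map_add, pow_succ, Module.End.mul_apply]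
    simp

theorem tendsto_pow_inv_apply_of_mem_maxGenEigenspace {V : Type*} [NormedAddCommGroup V]
    [NormedSpace ℂ V] {f f' : Module.End ℂ V} (hf : f' * f = 1) {z : ℂ} (hz : 1 < ‖z‖) {x : V}
    (hx : x ∈ maxGenEigenspace f z) : Tendsto (fun p => (f' ^ p) x) atTop (𝓝 0) := by
  rw [mem_maxGenEigenspace] at hx
  obtain ⟨k, hk⟩ := hx
  have hz0 : z ≠ 0 := by
    rintro rfl
    simp at hz
    linarith
  induction k generalizing x with
  | zero => simp only [pow_zero, Module.End.one_apply] at hk; simp [hk]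
  | succ k ih =>
    rw [pow_succ, Module.End.mul_apply] at hk
    have h1 : ‖z⁻¹‖ < 1 := by
      rw [norm_inv]
      exact inv_lt_one_of_one_lt₀ hz
    have h2 : Tendsto (fun p => -(z⁻¹ • (f' ^ (p + 1)) ((f - z • 1) x))) atTop (𝓝 0) := by
      simpa using (((tendsto_add_atTop_iff_nat 1).mpr (ih hk)).const_smul z⁻¹).neg
    refine tendsto_zero_of_recursion h1 h2 fun p => ?_
    have h3 : (f' ^ (p + 1)) (f x) = (f' ^ p) x := by
      rw [pow_succ, Module.End.mul_apply, ← Module.End.mul_apply f' f, hf, Module.End.one_apply]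
    simp only [LinearMap.sub_apply, LinearMap.smul_apply, Module.End.one_apply, map_sub, map_smul,
      h3, smul_sub, inv_smul_smul₀ hz0]
    abel

theorem toComplex_act_pow (g : GL ι ℝ) (v : EuclideanSpace ℝ ι) (p : ℕ) :
    toComplex (act (g ^ p) v) = (complexify g ^ p) (toComplex v) := by
  induction p with
  | zero => simp [act_one_apply]
  | succ p ih => rw [pow_succ', act_mul_apply, ← complexify_toComplex, ih, pow_succ',
      Module.End.mul_apply]

theorem tendsto_zero_of_toComplex {κ : Type} {w : ℕ → EuclideanSpace ℝ κ}
    (h : Tendsto (fun p => toComplex (w p)) atTop (𝓝 0)) : Tendsto w atTop (𝓝 0) := by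
  have h1 : Tendsto (fun p i => w p i) atTop (𝓝 (0 : κ → ℝ)) := by
    rw [tendsto_pi_nhds] at h ⊢
    intro i
    have := (Complex.continuous_re.tendsto _).comp (h i)
    simpa [toComplex, Function.comp_def] using this
  have h2 := ((EuclideanSpace.equiv κ ℝ).symm.continuous.tendsto 0).comp h1
  rw [map_zero] at h2
  exact h2

theorem tendsto_act_pow_of_mem_spectralSubspace {g : GL ι ℝ} {v : EuclideanSpace ℝ ι}
    (hv : v ∈ spectralSubspace g {z | ‖z‖ < 1}) :
    Tendsto (fun p => act (g ^ p) v) atTop (𝓝 0) := by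
  apply tendsto_zero_of_toComplex
  simp only [toComplex_act_pow]
  rw [mem_spectralSubspace] at hv
  generalize toComplex v = w at hv
  induction hv using Submodule.iSup_induction' with
  | mem z x hx =>
    by_cases hz : ‖z‖ < 1
    · exact tendsto_pow_apply_of_mem_maxGenEigenspace _ hz (by simpa [hz] using hx)
    · have : x = 0 := by simpa [hz] using hx
      simp [this]
  | zero => simp
  | add x y _ _ hx hy => simpa using hx.add hy

theorem tendsto_act_inv_pow_of_mem_spectralSubspace {g : GL ι ℝ} {v : EuclideanSpace ℝ ι}
    (hv : v ∈ spectralSubspace g {z | 1 < ‖z‖}) :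
    Tendsto (fun p => act (g⁻¹ ^ p) v) atTop (𝓝 0) := by
  apply tendsto_zero_of_toComplex
  simp only [toComplex_act_pow]
  rw [mem_spectralSubspace] at hv
  have hg : complexify g⁻¹ * complexify g = 1 := by
    rw [← complexify_mul, inv_mul_cancel, complexify_one]
  generalize toComplex v = w at hv
  induction hv using Submodule.iSup_induction' with
  | mem z x hx =>
    by_cases hz : 1 < ‖z‖
    · exact tendsto_pow_inv_apply_of_mem_maxGenEigenspace hg hz (by simpa [hz] using hx)
    · have : x = 0 := by simpa [hz] using hx
      simp [this]
  | zero => simp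
  | add x y _ _ hx hy => simpa using hx.add hy

/-- As g is real, conjugation permutes its generalized eigenspaces, and Re x = (x + x̄)/2. This
brings the complex splitting down to ℝ. -/
theorem exists_re_mem_spectralSubspace {g : GL ι ℝ} {S : Set ℂ}
    (hS : ∀ z ∈ S, (starRingEnd ℂ) z ∈ S) {x : ι → ℂ}
    (hx : x ∈ ⨆ z ∈ S, (complexify g).maxGenEigenspace z) :
    WithLp.toLp 2 (fun i => (x i).re) ∈ spectralSubspace g S := by
  have hc : conjVec x ∈ ⨆ z ∈ S, (complexify g).maxGenEigenspace z := by
    induction hx using Submodule.iSup_induction' with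
    | mem z x hx =>
      by_cases hz : z ∈ S
      · exact (le_iSup₂ (f := fun z (_ : z ∈ S) => (complexify g).maxGenEigenspace z) _ (hS z hz))
          (conjVec_mem_maxGenEigenspace g (by simpa [hz] using hx))
      · have : x = 0 := by simpa [hz] using hx
        rw [this]
        convert Submodule.zero_mem _ using 1
        ext i
        simp [conjVec]
    | zero =>
      convert Submodule.zero_mem _ using 1
      ext i
      simp [conjVec]
    | add x y _ _ hx hy =>
      convert Submodule.add_mem _ hx hy using 1
      ext i
      simp [conjVec]
  rw [mem_spectralSubspace]
  convert Submodule.smul_mem _ (1 / 2 : ℂ) (Submodule.add_mem _ hx hc) using 1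
  ext i
  simp [toComplex, conjVec, Complex.add_conj]

theorem spectralSubspace_sup_eq_top {g : GL ι ℝ}
    (hg : ∀ z : ℂ, (complexify g).HasEigenvalue z → ‖z‖ ≠ 1) :
    spectralSubspace g {z | ‖z‖ < 1} ⊔ spectralSubspace g {z | 1 < ‖z‖} = ⊤ := by
  rw [eq_top_iff]
  intro v _
  have htop : (⨆ z ∈ {z : ℂ | ‖z‖ < 1}, (complexify g).maxGenEigenspace z) ⊔
      (⨆ z ∈ {z : ℂ | 1 < ‖z‖}, (complexify g).maxGenEigenspace z) = ⊤ := by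
    rw [eq_top_iff, ← iSup_maxGenEigenspace_eq_top (complexify g)]
    refine iSup_le fun z => ?_
    rcases lt_trichotomy ‖z‖ 1 with hz | hz | hz
    · exact le_sup_of_le_left
        (le_iSup₂ (f := fun z (_ : z ∈ {z : ℂ | ‖z‖ < 1}) => (complexify g).maxGenEigenspace z)
          z hz)
    · have h1 : ¬ (complexify g).HasEigenvalue z := fun h => hg z h hz
      have h2 : (complexify g).maxGenEigenspace z = ⊥ := by
        rw [eq_bot_iff]
        intro x hx
        rw [mem_maxGenEigenspace] at hx
        obtain ⟨k, hk⟩ := hx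
        induction k with
        | zero => simpa using hk
        | succ k ih =>
          rw [pow_succ', Module.End.mul_apply] at hk
          refine ih ?_
          by_contra hne
          refine h1 (hasEigenvalue_of_hasEigenvector ⟨mem_eigenspace_iff.mpr ?_, hne⟩)
          simpa [sub_eq_zero] using hk
      rw [h2]
      exact bot_le
    · exact le_sup_of_le_right
        (le_iSup₂ (f := fun z (_ : z ∈ {z : ℂ | 1 < ‖z‖}) => (complexify g).maxGenEigenspace z)
          z hz)
  have hv : toComplex v ∈ (⨆ z ∈ {z : ℂ | ‖z‖ < 1}, (complexify g).maxGenEigenspace z) ⊔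
      (⨆ z ∈ {z : ℂ | 1 < ‖z‖}, (complexify g).maxGenEigenspace z) := by
    rw [htop]
    trivial
  obtain ⟨x, hx, y, hy, hxy⟩ := Submodule.mem_sup.mp hv
  refine Submodule.mem_sup.mpr ⟨_, exists_re_mem_spectralSubspace (by simp) hx, _,
    exists_re_mem_spectralSubspace (by simp) hy, ?_⟩
  ext i
  have := congrArg Complex.re (congrFun hxy i)
  simpa [toComplex] using this

end Spectral

/-! ### Real-variable estimates for the cutoff -/

section Estimates

open Filter Topology

/-- Cut (k, e] into blocks of length L. Within the first block b varies by a factor at most D^L, and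
each further block contributes at most half of the preceding bound: a geometric series. The bound
depends on the cocycle through L, which is harmless: only finiteness of a supremum is needed. -/
theorem mul_sum_inv_le_of_contracting {b : ℤ → ℝ} (hb : ∀ k, 0 < b k) {L : ℕ} (hL : 1 ≤ L)
    {D : ℝ} (hD : 1 ≤ D) (hbL : ∀ k, b (k - L) ≤ b k / 2) (hbD : ∀ k, b k ≤ D * b (k + 1))
    (e k : ℤ) : b k * ∑ j ∈ Finset.Ioc k e, (b j)⁻¹ ≤ 2 * (L * D ^ L) := by
  have hpow : ∀ (k : ℤ) (q : ℕ), b k ≤ D ^ q * b (k + q) := by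
    intro k q
    induction q with
    | zero => simp
    | succ q ih =>
      calc b k ≤ D ^ q * b (k + q) := ih
        _ ≤ D ^ q * (D * b (k + q + 1)) := by gcongr; exact hbD _
        _ = _ := by push_cast; rw [pow_succ, ← add_assoc]; ring
  have hblock : ∀ k : ℤ, b (k - L) * ∑ j ∈ Finset.Ioc (k - L) k, (b j)⁻¹ ≤ L * D ^ L := by
    intro k
    rw [Finset.mul_sum]
    have h1 : ∀ j ∈ Finset.Ioc (k - L) k, b (k - L) * (b j)⁻¹ ≤ D ^ L := by
      intro j hj
      rw [Finset.mem_Ioc] at hj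
      obtain ⟨q, hq⟩ := Int.le.dest (show k - L ≤ j by omega)
      have h2 := hpow (k - L) q
      rw [hq] at h2
      rw [← div_eq_mul_inv, div_le_iff₀ (hb j)]
      refine h2.trans ?_
      gcongr
      · exact (hb j).le
      · omega
    refine (Finset.sum_le_card_nsmul _ _ _ h1).trans ?_
    rw [Int.card_Ioc, nsmul_eq_mul]
    simp
  have key : ∀ (q : ℕ) (k : ℤ), e ≤ k + q * L →
      b k * ∑ j ∈ Finset.Ioc k e, (b j)⁻¹ ≤ 2 * (L * D ^ L) := by
    intro q
    induction q with
    | zero =>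
      intro k hk
      rw [Finset.Ioc_eq_empty (by simp at hk; omega)]
      simp
      positivity
    | succ q ih =>
      intro k hk
      have h1 := ih (k + L) (by push_cast at hk; linarith)
      have h2 := hblock (k + L)
      have h3 := hbL (k + L)
      rw [add_sub_cancel_right] at h2 h3
      have h4 : ∑ j ∈ Finset.Ioc k e, (b j)⁻¹ ≤
          ∑ j ∈ Finset.Ioc k (k + L), (b j)⁻¹ + ∑ j ∈ Finset.Ioc (k + L) e, (b j)⁻¹ := by
        rw [← Finset.sum_union]
        · refine Finset.sum_le_sum_of_subset_of_nonneg ?_ fun j _ _ => (inv_pos.mpr (hb j)).le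
          intro j hj
          simp only [Finset.mem_union, Finset.mem_Ioc] at hj ⊢
          omega
        · rw [Finset.disjoint_left]
          intro j hj hj'
          simp only [Finset.mem_Ioc] at hj hj'
          omega
      have h5 : 0 ≤ ∑ j ∈ Finset.Ioc (k + L) e, (b j)⁻¹ :=
        Finset.sum_nonneg fun j _ => (inv_pos.mpr (hb j)).le
      calc b k * ∑ j ∈ Finset.Ioc k e, (b j)⁻¹
          ≤ b k * (∑ j ∈ Finset.Ioc k (k + L), (b j)⁻¹ +
            ∑ j ∈ Finset.Ioc (k + L) e, (b j)⁻¹) := by gcongr; exact (hb k).le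
        _ = b k * ∑ j ∈ Finset.Ioc k (k + L), (b j)⁻¹ +
            b k * ∑ j ∈ Finset.Ioc (k + L) e, (b j)⁻¹ := by ring
        _ ≤ L * D ^ L + b (k + L) / 2 * ∑ j ∈ Finset.Ioc (k + L) e, (b j)⁻¹ := by gcongr
        _ ≤ _ := by linarith
  refine key (e - k).toNat k ?_
  have h1 : ((e - k).toNat : ℤ) * 1 ≤ (e - k).toNat * L := by gcongr; exact_mod_cast hL
  omega

/-- The tent function of half-width `m` centred at `c`. -/
def tent (m : ℕ) (c k : ℤ) : ℝ := max 0 (1 - |(k : ℝ) - c| / m)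

theorem tent_nonneg (m : ℕ) (c k : ℤ) : 0 ≤ tent m c k := le_max_left _ _

theorem tent_le_one (m : ℕ) (c k : ℤ) : tent m c k ≤ 1 :=
  max_le zero_le_one (by have : 0 ≤ |(k : ℝ) - c| / m := by positivity
                         linarith)

theorem tent_self (m : ℕ) (c : ℤ) : tent m c c = 1 := by simp [tent]

theorem tent_eq_zero {m : ℕ} (hm : 1 ≤ m) {c k : ℤ} (h : (m : ℤ) ≤ |k - c|) : tent m c k = 0 := by
  refine max_eq_left ?_
  have h1 : (m : ℝ) ≤ |(k : ℝ) - c| := by exact_mod_cast h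
  have h2 : (0 : ℝ) < m := by exact_mod_cast hm
  rw [sub_nonpos, le_div_iff₀ h2]
  linarith

theorem abs_tent_succ_sub_le (m : ℕ) (c k : ℤ) : |tent m c (k + 1) - tent m c k| ≤ 1 / m := by
  unfold tent
  refine (abs_max_sub_max_le_max _ _ _ _).trans ?_
  rw [sub_self, abs_zero]
  refine max_le (by positivity) ?_
  rw [sub_sub_sub_cancel_left, ← sub_div, abs_div, Nat.abs_cast]
  gcongr
  refine (abs_abs_sub_abs_le_abs_sub _ _).trans ?_
  push_cast
  rw [show ((k : ℝ) - c - (k + 1 - c)) = -1 by ring]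
  simp

/-- The sequence is a multiple of a tent times S_k = ∑ 1/b_j over k < j ≤ e, centred where b_k S_k
is nearly maximal. The slope 1/m of the tent costs at most (sup b S)/m, and the increment of S costs
1, which is less than this because the supremum exceeds m. After normalizing b_c S_c to Q both are
of order Q/m. -/
theorem exists_cutoff {Q η δ : ℝ} (hQ : 0 < Q) (hη : 0 < η) (hδ : 0 < δ) :
    ∃ m N : ℕ, 1 ≤ m ∧ 1 ≤ N ∧ ∀ (b : ℤ → ℝ), (∀ k, 0 < b k) → ∀ (i : ℤ) (n : ℕ), N ≤ n →
      δ * b (i + n) ≤ b i → (∃ M, ∀ k, b k * ∑ j ∈ Finset.Ioc k (i + n), (b j)⁻¹ ≤ M) →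
      ∃ (a : ℤ → ℝ) (c : ℤ), |a c| * b c = Q ∧ (∀ k, |a (k + 1) - a k| * b (k + 1) ≤ η) ∧
        ∀ k, (m : ℤ) ≤ |k - c| → a k = 0 := by
  obtain ⟨m₀, hm₀⟩ := exists_nat_ge (4 * Q / η)
  obtain ⟨m, hm1, hm2⟩ : ∃ m : ℕ, 1 ≤ m ∧ 4 * Q / η ≤ m :=
    ⟨m₀ + 1, by omega, by push_cast; linarith⟩
  have hm : (0 : ℝ) < m := by exact_mod_cast hm1
  have hr : (1 : ℝ) < 1 + 1 / m := by have : (0 : ℝ) < 1 / m := by positivity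
                                      linarith
  obtain ⟨P, hP⟩ := pow_unbounded_of_one_lt ((m : ℝ) / δ) hr
  refine ⟨m, P + 1, hm1, by omega, ?_⟩
  rintro b hb i n hn hbi ⟨M, hM⟩
  set e : ℤ := i + n with he
  set S : ℤ → ℝ := fun k => ∑ j ∈ Finset.Ioc k e, (b j)⁻¹ with hS
  have hS0 : ∀ k, e ≤ k → S k = 0 := by
    intro k hk
    simp only [hS]
    rw [Finset.Ioc_eq_empty (by omega), Finset.sum_empty]
  have hSnn : ∀ k, 0 ≤ S k := fun k => Finset.sum_nonneg fun j _ => (inv_pos.mpr (hb j)).le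
  have hSs : ∀ k, k < e → S k = S (k + 1) + (b (k + 1))⁻¹ := by
    intro k hk
    simp only [hS]
    have : Finset.Ioc k e = insert (k + 1) (Finset.Ioc (k + 1) e) := by
      ext j
      simp only [Finset.mem_insert, Finset.mem_Ioc]
      omega
    rw [this, Finset.sum_insert (by simp), add_comm]
  -- If b_k S_k ≤ m throughout, then S_{k−1} = S_k + 1/b_k ≥ (1 + 1/m) S_k. After n − 1 ≥ P backward
  -- steps from S_{e−1} = 1/b_e this gives b_i S_i > m, by δ b_e ≤ b_i.
  have hbig : ∃ k, (m : ℝ) < b k * S k := by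
    by_contra! hcon
    have hgrow : ∀ p : ℕ, (1 + 1 / (m : ℝ)) ^ p * (b e)⁻¹ ≤ S (e - 1 - p) := by
      intro p
      induction p with
      | zero =>
        rw [hSs _ (by push_cast; omega), hS0 _ (by push_cast; omega)]
        simp
      | succ p ih =>
        have h1 : S (e - 1 - p) / m ≤ (b (e - 1 - p))⁻¹ := by
          rw [div_le_iff₀ hm, inv_mul_eq_div, le_div_iff₀ (hb _)]
          linarith [hcon (e - 1 - p)]
        rw [hSs _ (by push_cast; omega)]
        rw [show e - 1 - ((p + 1 : ℕ) : ℤ) + 1 = e - 1 - p by push_cast; ring]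
        calc (1 + 1 / (m : ℝ)) ^ (p + 1) * (b e)⁻¹
            = (1 + 1 / (m : ℝ)) * ((1 + 1 / (m : ℝ)) ^ p * (b e)⁻¹) := by ring
          _ ≤ (1 + 1 / (m : ℝ)) * S (e - 1 - p) := by gcongr
          _ = S (e - 1 - p) + S (e - 1 - p) / m := by ring
          _ ≤ _ := by gcongr
    have h1 := hgrow (n - 1)
    rw [show e - 1 - ((n - 1 : ℕ) : ℤ) = i by omega] at h1
    have h2 : (m : ℝ) / δ < (1 + 1 / (m : ℝ)) ^ (n - 1) :=
      hP.trans_le (pow_le_pow_right₀ hr.le (by omega))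
    rw [div_lt_iff₀ hδ] at h2
    have h3 : δ * b e * ((1 + 1 / (m : ℝ)) ^ (n - 1) * (b e)⁻¹) ≤ m :=
      calc _ ≤ b i * S i := by
            refine mul_le_mul hbi h1 ?_ (hb i).le
            have := hb e
            positivity
        _ ≤ m := hcon i
    have h4 : δ * b e * ((1 + 1 / (m : ℝ)) ^ (n - 1) * (b e)⁻¹) =
        (1 + 1 / (m : ℝ)) ^ (n - 1) * δ := by
      have := (hb e).ne'
      field_simp
    linarith
  obtain ⟨k₁, hk₁⟩ := hbig
  have hbdd : BddAbove (Set.range fun k => b k * S k) := ⟨M, by rintro _ ⟨k, rfl⟩; exact hM k⟩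
  set s := ⨆ k, b k * S k with hs
  have hle : ∀ k, b k * S k ≤ s := fun k => le_ciSup hbdd k
  have hsm : (m : ℝ) < s := hk₁.trans_le (hle k₁)
  have hs0 : 0 < s := hm.trans hsm
  -- The supremum runs over all of ℤ and may not be attained; half of it suffices. The index c need
  -- not lie between i and i + n.
  obtain ⟨c, hc⟩ := exists_lt_of_lt_ciSup (show s / 2 < ⨆ k, b k * S k by rw [← hs]; linarith)
  have hc0 : 0 < b c * S c := by linarith
  set θ := Q / (b c * S c) with hθ
  have hθ0 : 0 < θ := by positivity
  have hθle : θ * s ≤ 2 * Q := by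
    rw [hθ, div_mul_eq_mul_div, div_le_iff₀ hc0]
    nlinarith
  refine ⟨fun k => θ * (tent m c k * S k), c, ?_, ?_, ?_⟩
  · show |θ * (tent m c c * S c)| * b c = Q
    rw [tent_self, one_mul, abs_of_nonneg (mul_nonneg hθ0.le (hSnn c)), hθ]
    rw [mul_assoc, mul_comm (S c), div_mul_cancel₀ _ hc0.ne']
  · intro k
    simp only
    rcases lt_or_ge k e with hk | hk
    · have h0 := hb (k + 1)
      have h1 : θ * (tent m c (k + 1) * S (k + 1)) - θ * (tent m c k * S k) =
          θ * ((tent m c (k + 1) - tent m c k) * S (k + 1) - tent m c k * (b (k + 1))⁻¹) := by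
        rw [hSs k hk]; ring
      have h2 : |(tent m c (k + 1) - tent m c k) * S (k + 1) - tent m c k * (b (k + 1))⁻¹| ≤
          1 / m * S (k + 1) + 1 * (b (k + 1))⁻¹ := by
        refine (abs_sub _ _).trans ?_
        rw [abs_mul, abs_mul, abs_of_nonneg (hSnn (k + 1)), abs_of_nonneg (tent_nonneg m c k),
          abs_of_pos (inv_pos.mpr h0)]
        have := hSnn (k + 1)
        gcongr
        · exact abs_tent_succ_sub_le m c k
        · exact tent_le_one m c k
      rw [h1, abs_mul, abs_of_pos hθ0]
      calc θ * _ * b (k + 1) ≤ θ * (1 / m * S (k + 1) + 1 * (b (k + 1))⁻¹) * b (k + 1) := by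
            gcongr
        _ = θ * ((b (k + 1) * S (k + 1)) / m + 1) := by field_simp
        _ ≤ θ * (s / m + s / m) := by
            gcongr
            · exact hle _
            · rw [le_div_iff₀ hm]; linarith
        _ = 2 * (θ * s) / m := by ring
        _ ≤ 2 * (2 * Q) / m := by gcongr
        _ ≤ η := by
            rw [div_le_iff₀ hη] at hm2
            rw [div_le_iff₀ hm]
            linarith
    · rw [hS0 k hk, hS0 (k + 1) (by omega)]
      simp [hη.le]
  · intro k hk
    simp [tent_eq_zero hm1 hk]

/-! ### Angles versus norms, and uniform decay on a subspace -/

section Angle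

variable {V : Type*} [NormedAddCommGroup V] [InnerProductSpace ℝ V]

open InnerProductGeometry

/-- By the law of cosines, ‖u + w‖² ≥ (‖w‖ − cos ε ‖u‖)² + sin² ε ‖u‖². -/
theorem sin_mul_norm_le_norm_add {ε : ℝ} (hε : 0 ≤ ε) (hε' : ε ≤ 1) {u w : V}
    (h : u ≠ 0 → w ≠ 0 → ε ≤ angle u (-w)) : Real.sin ε * ‖u‖ ≤ ‖u + w‖ := by
  by_cases hu : u = 0
  · simp [hu]
  by_cases hw : w = 0
  · simp only [hw, add_zero]
    exact mul_le_of_le_one_left (norm_nonneg u) (Real.sin_le_one ε)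
  have hπ := Real.pi_gt_three
  have h1 : Real.cos (angle u (-w)) ≤ Real.cos ε :=
    Real.cos_le_cos_of_nonneg_of_le_pi hε (angle_le_pi _ _) (h hu hw)
  have h2 := cos_angle_mul_norm_mul_norm u (-w)
  rw [norm_neg, inner_neg_right] at h2
  have h3 : 0 ≤ ‖u‖ * ‖w‖ := by positivity
  have h4 := norm_add_sq_real u w
  have h5 := Real.sin_sq_add_cos_sq ε
  have h6 : (Real.sin ε * ‖u‖) ^ 2 ≤ ‖u + w‖ ^ 2 := by
    have h7 : -(inner ℝ u w) ≤ Real.cos ε * (‖u‖ * ‖w‖) := by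
      rw [← h2]; gcongr
    nlinarith [sq_nonneg (‖w‖ - Real.cos ε * ‖u‖)]
  have h8 : 0 ≤ Real.sin ε := Real.sin_nonneg_of_nonneg_of_le_pi hε (by linarith)
  exact (sq_le_sq₀ (by positivity) (norm_nonneg _)).mp h6

theorem angle_add_lt {ε : ℝ} (hε : 0 < ε) (hε' : ε ≤ 1) {x y : V} (hy : y ≠ 0)
    (hx : ‖x‖ ≤ (1 - Real.cos ε) / 4 * ‖y‖) : x + y ≠ 0 ∧ angle (x + y) y < ε := by
  have hπ := Real.pi_gt_three
  have hy0 : 0 < ‖y‖ := norm_pos_iff.mpr hy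
  have hc1 : Real.cos ε < 1 := by
    rw [← Real.cos_zero]
    exact Real.cos_lt_cos_of_nonneg_of_le_pi le_rfl (by linarith) hε
  have hc0 : 0 < Real.cos ε := Real.cos_pos_of_mem_Ioo ⟨by linarith, by linarith⟩
  set ρ := (1 - Real.cos ε) / 4 with hρ
  have hρ0 : 0 < ρ := by rw [hρ]; linarith
  have hρ1 : ρ < 1 / 4 := by rw [hρ]; linarith
  have hxy : x + y ≠ 0 := by
    intro h0
    have : ‖x‖ = ‖y‖ := by rw [eq_neg_of_add_eq_zero_left h0, norm_neg]
    nlinarith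
  refine ⟨hxy, ?_⟩
  have hxy0 : 0 < ‖x + y‖ := norm_pos_iff.mpr hxy
  have h1 : ‖x + y‖ ≤ (1 + ρ) * ‖y‖ := (norm_add_le _ _).trans (by linarith)
  have h2 : (1 - ρ) * ‖y‖ ^ 2 ≤ inner ℝ (x + y) y := by
    rw [inner_add_left, real_inner_self_eq_norm_sq]
    have := neg_le_of_abs_le (abs_real_inner_le_norm x y)
    nlinarith
  have h3 : Real.cos ε < Real.cos (angle (x + y) y) := by
    rw [cos_angle, lt_div_iff₀ (by positivity)]
    calc Real.cos ε * (‖x + y‖ * ‖y‖) ≤ Real.cos ε * ((1 + ρ) * ‖y‖ * ‖y‖) := by gcongr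
      _ = (Real.cos ε * (1 + ρ)) * ‖y‖ ^ 2 := by ring
      _ < (1 - ρ) * ‖y‖ ^ 2 := by
        gcongr
        nlinarith
      _ ≤ _ := h2
  by_contra! hcon
  exact absurd (Real.cos_le_cos_of_nonneg_of_le_pi hε.le (angle_le_pi _ _) hcon) (not_le.mpr h3)

/-- In finite dimension, convergence on an orthonormal basis of E is uniform on its unit ball. -/
theorem eventually_norm_le_mul_norm [FiniteDimensional ℝ V] {E : Submodule ℝ V}
    {f : ℕ → V →L[ℝ] V} (h : ∀ x ∈ E, Tendsto (fun p => f p x) atTop (𝓝 0)) {δ : ℝ} (hδ : 0 < δ) :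
    ∀ᶠ p in atTop, ∀ x ∈ E, ‖f p x‖ ≤ δ * ‖x‖ := by
  set B := stdOrthonormalBasis ℝ E
  have h1 : Tendsto (fun p => ∑ i, ‖f p (B i : V)‖) atTop (𝓝 0) := by
    have : Tendsto (fun p => ∑ i, ‖f p (B i : V)‖) atTop
        (𝓝 (∑ i : Fin (Module.finrank ℝ E), ‖(0 : V)‖)) :=
      tendsto_finsetSum _ fun i _ => (h _ (B i).2).norm
    simpa using this
  filter_upwards [h1.eventually (ge_mem_nhds hδ)] with p hp x hx
  have h2 : x = ∑ i, inner ℝ (B i) (⟨x, hx⟩ : E) • (B i : V) := by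
    have := congrArg (Subtype.val) (B.sum_repr' ⟨x, hx⟩)
    simpa using this.symm
  calc ‖f p x‖ = ‖∑ i, inner ℝ (B i) (⟨x, hx⟩ : E) • f p (B i : V)‖ := by
        conv_lhs => rw [h2]
        simp
    _ ≤ ∑ i, ‖x‖ * ‖f p (B i : V)‖ := by
        refine (norm_sum_le _ _).trans (Finset.sum_le_sum fun i _ => ?_)
        rw [norm_smul]
        gcongr
        refine (norm_inner_le_norm _ _).trans ?_
        rw [B.orthonormal.1 i, one_mul]
        rfl
    _ = ‖x‖ * ∑ i, ‖f p (B i : V)‖ := by rw [Finset.mul_sum]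
    _ ≤ δ * ‖x‖ := by rw [mul_comm]; gcongr

end Angle

end Estimates

/-! ### Shears, conjugated cocycles and equivariant shear families -/

section Shear

open Filter Topology

variable {ι : Type} [Fintype ι] [DecidableEq ι]

/-- The unipotent matrix `1 + aX`, where `X² = 0`. -/
def shear (X : Matrix ι ι ℝ) (hX : X * X = 0) (a : ℝ) : GL ι ℝ where
  val := 1 + a • X
  inv := 1 - a • X
  val_inv := by simp [mul_sub, add_mul, hX]
  inv_val := by simp [mul_add, sub_mul, hX]

theorem shear_val (X : Matrix ι ι ℝ) (hX : X * X = 0) (a : ℝ) :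
    (shear X hX a : Matrix ι ι ℝ) = 1 + a • X := rfl

theorem shear_zero (X : Matrix ι ι ℝ) (hX : X * X = 0) : shear X hX 0 = 1 := by
  ext1
  simp [shear_val]

theorem shear_add (X : Matrix ι ι ℝ) (hX : X * X = 0) (a b : ℝ) :
    shear X hX (a + b) = shear X hX a * shear X hX b := by
  ext1
  simp [shear_val, mul_add, add_mul, hX, add_smul, add_assoc]

theorem shear_inv (X : Matrix ι ι ℝ) (hX : X * X = 0) (a : ℝ) :
    (shear X hX a)⁻¹ = shear X hX (-a) := by
  rw [inv_eq_iff_mul_eq_one, ← shear_add, add_neg_cancel, shear_zero]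

theorem mul_shear {X Y : Matrix ι ι ℝ} (hX : X * X = 0) (hY : Y * Y = 0) {g : GL ι ℝ}
    (h : Y * (g : Matrix ι ι ℝ) = (g : Matrix ι ι ℝ) * X) (a : ℝ) :
    g * shear X hX a = shear Y hY a * g := by
  ext1
  simp [shear_val, mul_add, add_mul, h]

theorem continuous_shear (X : Matrix ι ι ℝ) (hX : X * X = 0) : Continuous (shear X hX) := by
  rw [Units.continuous_iff]
  constructor
  · show Continuous fun a : ℝ => 1 + a • X
    fun_prop
  · show Continuous fun a : ℝ => 1 - a • X
    fun_prop

/-- The operator on Euclidean space defined by a matrix. -/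
abbrev op (X : Matrix ι ι ℝ) : EuclideanSpace ℝ ι →L[ℝ] EuclideanSpace ℝ ι :=
  Matrix.toEuclideanCLM (𝕜 := ℝ) X

theorem op_mul_apply (X Y : Matrix ι ι ℝ) (v : EuclideanSpace ℝ ι) :
    op (X * Y) v = op X (op Y v) := by
  rw [op, map_mul]; rfl

theorem act_shear_apply (X : Matrix ι ι ℝ) (hX : X * X = 0) (a : ℝ) (v : EuclideanSpace ℝ ι) :
    act (shear X hX a) v = v + a • op X v := by
  simp [act, shear_val]

theorem norm_op_pos {X : Matrix ι ι ℝ} (hX : X ≠ 0) : 0 < ‖op X‖ := by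
  rw [norm_pos_iff]
  simpa [op] using hX

theorem norm_act_sub_act_shear_mul_le (g : GL ι ℝ) (X : Matrix ι ι ℝ) (hX : X * X = 0) (a : ℝ) :
    ‖act g - act (shear X hX a * g)‖ ≤ |a| * ‖op X‖ * ‖act g‖ := by
  have : act g - act (shear X hX a * g) = -(a • (op X * act g)) := by
    simp [act, shear_val, add_mul]
  rw [this, norm_neg, norm_smul, mul_assoc, Real.norm_eq_abs]
  exact mul_le_mul_of_nonneg_left (norm_mul_le _ _) (abs_nonneg a)

theorem norm_act_inv_sub_act_inv_shear_mul_le (g : GL ι ℝ) (X : Matrix ι ι ℝ) (hX : X * X = 0)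
    (a : ℝ) :
    ‖act g⁻¹ - act (shear X hX a * g)⁻¹‖ ≤ |a| * ‖op X‖ * ‖act g⁻¹‖ := by
  have : act g⁻¹ - act (shear X hX a * g)⁻¹ = a • (act g⁻¹ * op X) := by
    have h : ((g⁻¹ : GL ι ℝ) : Matrix ι ι ℝ) - ((shear X hX a * g)⁻¹ : GL ι ℝ) =
        a • ((g⁻¹ : GL ι ℝ) * X) := by
      rw [mul_inv_rev, shear_inv, Units.val_mul, shear_val, mul_add, mul_one, neg_smul, mul_neg,
        Matrix.mul_smul]
      abel
    simp only [act, op, ← map_sub, h, map_smul, map_mul]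
  rw [this, norm_smul, mul_assoc, mul_comm ‖op X‖, Real.norm_eq_abs]
  exact mul_le_mul_of_nonneg_left (norm_mul_le _ _) (abs_nonneg a)

namespace PeriodicCocycle

variable {G : Subgroup (GL ι ℝ)} {ℓ : ℕ}

/-- A two-sided solution of the cocycle equation, normalized to 1 at index 0. It turns identities
between products into group identities and transports matrices to every index. -/
theorem exists_transport (A : PeriodicCocycle G ℓ) :
    ∃ Ψ : ℤ → GL ι ℝ, (∀ k, Ψ k ∈ G) ∧ ∀ k, Ψ (k + 1) = A.toFun k * Ψ k := by
  have hp : ∀ n, A.prod 0 n ∈ G := by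
    intro n
    induction n with
    | zero => exact G.one_mem
    | succ n ih => exact G.mul_mem (A.mem _) ih
  -- `f n` is the value at −n; `Int.negSucc n` is −(n + 1).
  let f : ℕ → GL ι ℝ := fun n =>
    Nat.rec 1 (fun n x => (A.toFun (Int.negSucc n))⁻¹ * x) n
  have hf : ∀ n, f n ∈ G := by
    intro n
    induction n with
    | zero => exact G.one_mem
    | succ n ih => exact G.mul_mem (G.inv_mem (A.mem _)) ih
  have hfs : ∀ n, f n = A.toFun (Int.negSucc n) * f (n + 1) := fun n =>
    (mul_inv_cancel_left _ _).symm
  refine ⟨fun k => Int.rec (fun n => A.prod 0 n) (fun n => f (n + 1)) k, ?_, ?_⟩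
  · rintro (n | n)
    · exact hp n
    · exact hf (n + 1)
  · rintro (n | n)
    · show A.toFun (0 + n) * A.prod 0 n = _
      rw [zero_add]
      rfl
    · cases n with
      | zero => exact hfs 0
      | succ n => exact hfs (n + 1)

theorem prod_eq_transport (A : PeriodicCocycle G ℓ) {Ψ : ℤ → GL ι ℝ}
    (hΨ : ∀ k, Ψ (k + 1) = A.toFun k * Ψ k) (i : ℤ) (n : ℕ) :
    A.prod i n = Ψ (i + n) * (Ψ i)⁻¹ := by
  induction n with
  | zero => simp [prod]
  | succ n ih =>
    rw [prod, ih, Nat.cast_succ, ← add_assoc, hΨ, mul_assoc]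

theorem toFun_mul_prod (A : PeriodicCocycle G ℓ) (k : ℤ) :
    A.toFun k * A.prod k ℓ = A.prod (k + 1) ℓ * A.toFun k := by
  obtain ⟨Ψ, -, hΨ⟩ := A.exists_transport
  rw [A.prod_eq_transport hΨ, A.prod_eq_transport hΨ, hΨ k, ← A.periodic k, ← mul_assoc, ← hΨ,
    add_right_comm]
  rw [A.periodic k]
  group

theorem prod_add_period (A : PeriodicCocycle G ℓ) (k : ℤ) (n : ℕ) :
    A.prod (k + ℓ) n = A.prod k n := by
  induction n with
  | zero => rfl
  | succ n ih => rw [prod, prod, ih, add_right_comm, A.periodic]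

theorem toFun_congr (A : PeriodicCocycle G ℓ) {j k : ℤ} (h : j ≡ k [ZMOD ℓ]) :
    A.toFun j = A.toFun k := by
  obtain ⟨c, hc⟩ := h.symm.dvd
  have : Function.Periodic A.toFun (ℓ : ℤ) := A.periodic
  rw [show j = k + c * ℓ by linarith]
  exact this.int_mul c k

theorem prod_congr (A : PeriodicCocycle G ℓ) {j k : ℤ} (h : j ≡ k [ZMOD ℓ]) (n : ℕ) :
    A.prod j n = A.prod k n := by
  obtain ⟨c, hc⟩ := h.symm.dvd
  have : Function.Periodic (fun k => A.prod k n) (ℓ : ℤ) := fun k => A.prod_add_period k n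
  rw [show j = k + c * ℓ by linarith]
  exact this.int_mul c k

theorem BoundedBy.norm_le {A : PeriodicCocycle G ℓ} {C : ℝ} (h : A.BoundedBy C) (k : ℤ) :
    ‖act (A.toFun k)‖ ≤ C ∧ ‖act (A.toFun k)⁻¹‖ ≤ C := by
  have hℓ : (0 : ℤ) < ℓ := by exact_mod_cast A.one_le_period
  have h1 : A.toFun (1 + (k - 1) % ℓ) = A.toFun k := by
    refine A.toFun_congr ?_
    have := (Int.mod_modEq (k - 1) ℓ).add_left 1
    simpa using this
  have h2 := h (1 + (k - 1) % ℓ) (by have := Int.emod_nonneg (k - 1) hℓ.ne'; omega)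
    (by have := Int.emod_lt_of_pos (k - 1) hℓ; omega)
  rw [h1] at h2
  exact max_le_iff.mp h2

theorem Hyperbolic.norm_ne_one {A : PeriodicCocycle G ℓ} (h : A.Hyperbolic) (k : ℤ) (z : ℂ)
    (hz : (complexify (A.prod k ℓ)).HasEigenvalue z) : ‖z‖ ≠ 1 := by
  have h1 : ∀ k, (complexify (A.prod k ℓ)).HasEigenvalue z →
      (complexify (A.prod (k + 1) ℓ)).HasEigenvalue z := fun k hz =>
    hasEigenvalue_of_conj (A.toFun_mul_prod k) hz
  have h2 : ∀ n : ℕ, (complexify (A.prod (k + n) ℓ)).HasEigenvalue z := by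
    intro n
    induction n with
    | zero => simpa using hz
    | succ n ih =>
      rw [Nat.cast_succ, ← add_assoc]
      exact h1 _ ih
  have hℓ : (0 : ℤ) < ℓ := by exact_mod_cast A.one_le_period
  refine h z ?_
  have h3 := h2 ((1 - k) % ℓ).toNat
  rwa [Int.toNat_of_nonneg (Int.emod_nonneg _ hℓ.ne'),
    A.prod_congr (k := 1) (by simpa using (Int.mod_modEq (1 - k) ℓ).add_left k)] at h3

theorem stableSpace_sup_unstableSpace {A : PeriodicCocycle G ℓ} (h : A.Hyperbolic) (k : ℤ) :
    A.stableSpace k ⊔ A.unstableSpace k = ⊤ :=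
  spectralSubspace_sup_eq_top fun z hz => h.norm_ne_one k z hz

theorem sub_mul_modEq (k p ℓ : ℤ) : k - p * ℓ ≡ k [ZMOD ℓ] :=
  Int.modEq_iff_dvd.mpr ⟨p, by ring⟩

theorem eventually_forall_of_periodic (A : PeriodicCocycle G ℓ) {P : ℕ → GL ι ℝ → Prop}
    (h : ∀ k, ∀ᶠ p in atTop, P p (A.prod k ℓ)) : ∀ᶠ p in atTop, ∀ k, P p (A.prod k ℓ) := by
  have hℓ : (0 : ℤ) < ℓ := by exact_mod_cast A.one_le_period
  have h1 : ∀ᶠ p in atTop, ∀ r ∈ Finset.Ico (0 : ℤ) ℓ, P p (A.prod r ℓ) :=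
    (Finset.eventually_all _).mpr fun r _ => h r
  filter_upwards [h1] with p hp k
  rw [← A.prod_congr (Int.mod_modEq k ℓ)]
  exact hp _ (Finset.mem_Ico.mpr ⟨Int.emod_nonneg _ hℓ.ne', Int.emod_lt_of_pos _ hℓ⟩)

/-- The cocycle obtained from `A` by the periodic change of coordinates `H`. -/
def conj (A : PeriodicCocycle G ℓ) (H : ℤ → GL ι ℝ) (hH : ∀ k, H k ∈ G)
    (hp : ∀ k, H (k + ℓ) = H k) : PeriodicCocycle G ℓ where
  toFun k := H (k + 1) * A.toFun k * (H k)⁻¹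
  mem k := G.mul_mem (G.mul_mem (hH _) (A.mem k)) (G.inv_mem (hH k))
  one_le_period := A.one_le_period
  periodic k := by rw [hp, A.periodic, add_right_comm, hp]

section Conj

variable (A : PeriodicCocycle G ℓ) (H : ℤ → GL ι ℝ) (hH : ∀ k, H k ∈ G)
  (hp : ∀ k, H (k + ℓ) = H k)

theorem conj_prod (k : ℤ) (n : ℕ) :
    (A.conj H hH hp).prod k n = H (k + n) * A.prod k n * (H k)⁻¹ := by
  induction n with
  | zero => simp [prod]
  | succ n ih =>
    rw [prod, ih, prod, Nat.cast_succ, ← add_assoc]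
    simp only [conj]
    group

theorem mul_prod_conj (k : ℤ) : H k * A.prod k ℓ = (A.conj H hH hp).prod k ℓ * H k := by
  rw [conj_prod, hp]
  group

theorem conj_hyperbolic (h : A.Hyperbolic) : (A.conj H hH hp).Hyperbolic := fun z hz =>
  h z (hasEigenvalue_of_conj (h := (H 1)⁻¹) (by
    rw [periodProd, periodProd, inv_mul_eq_iff_eq_mul, ← mul_assoc, A.mul_prod_conj H hH hp]
    group) hz)

theorem act_mem_conj_stableSpace {k : ℤ} {v : EuclideanSpace ℝ ι} (hv : v ∈ A.stableSpace k) :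
    act (H k) v ∈ (A.conj H hH hp).stableSpace k :=
  act_mem_spectralSubspace (A.mul_prod_conj H hH hp k) hv

theorem act_mem_conj_unstableSpace {k : ℤ} {v : EuclideanSpace ℝ ι} (hv : v ∈ A.unstableSpace k) :
    act (H k) v ∈ (A.conj H hH hp).unstableSpace k :=
  act_mem_spectralSubspace (A.mul_prod_conj H hH hp k) hv

end Conj

/-- An equivariant family of square-zero matrices `X k`, with image in the unstable space and
vanishing on it, such that the matrices `1 + a X k` belong to `G`. -/
structure IsShearFamily (A : PeriodicCocycle G ℓ) (X : ℤ → Matrix ι ι ℝ) : Prop where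
  equivariant : ∀ k, X (k + 1) * (A.toFun k : Matrix ι ι ℝ) = (A.toFun k : Matrix ι ι ℝ) * X k
  sq_zero : ∀ k, X k * X k = 0
  ne_zero : ∀ k, X k ≠ 0
  op_mem : ∀ k v, op (X k) v ∈ A.unstableSpace k
  op_eq_zero : ∀ k, ∀ v ∈ A.unstableSpace k, op (X k) v = 0
  shear_mem : ∀ k a, shear (X k) (sq_zero k) a ∈ G

namespace IsShearFamily

variable {A : PeriodicCocycle G ℓ} {X : ℤ → Matrix ι ι ℝ}

theorem equivariant_prod (hX : A.IsShearFamily X) (k : ℤ) (n : ℕ) :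
    X (k + n) * (A.prod k n : Matrix ι ι ℝ) = (A.prod k n : Matrix ι ι ℝ) * X k := by
  induction n with
  | zero => simp [prod]
  | succ n ih =>
    rw [prod, Nat.cast_succ, ← add_assoc, Units.val_mul, ← mul_assoc, hX.equivariant, mul_assoc,
      ih, mul_assoc]

theorem norm_le_succ (hX : A.IsShearFamily X) {C : ℝ} (hC : 0 ≤ C) (hA : A.BoundedBy C) (k : ℤ) :
    ‖op (X k)‖ ≤ C ^ 2 * ‖op (X (k + 1))‖ := by
  have h1 : X k = ((A.toFun k)⁻¹ : GL ι ℝ) * (X (k + 1) * (A.toFun k : Matrix ι ι ℝ)) := by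
    rw [hX.equivariant, Units.inv_mul_cancel_left]
  have h2 : op (X k) = act (A.toFun k)⁻¹ * (op (X (k + 1)) * act (A.toFun k)) := by
    rw [h1]
    simp only [op, act, map_mul]
  rw [h2]
  refine (norm_mul_le _ _).trans ?_
  calc _ ≤ C * (‖op (X (k + 1))‖ * C) := by
        gcongr
        · exact (hA.norm_le k).2
        · refine (norm_mul_le _ _).trans ?_
          gcongr
          exact (hA.norm_le k).1
    _ = _ := by ring

theorem op_sub_mul_period (hX : A.IsShearFamily X) (k : ℤ) (p : ℕ) (v : EuclideanSpace ℝ ι) :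
    op (X (k - p * ℓ)) v =
      act ((A.prod k ℓ)⁻¹ ^ p) (op (X k) (act (A.prod k ℓ ^ p) v)) := by
  induction p generalizing v with
  | zero => simp [act_one_apply]
  | succ p ih =>
    have h1 := hX.equivariant_prod (k - (p + 1 : ℕ) * ℓ) ℓ
    rw [show k - ((p + 1 : ℕ) : ℤ) * ℓ + ℓ = k - p * ℓ by push_cast; ring] at h1
    rw [A.prod_congr (k := k) (sub_mul_modEq _ _ _)] at h1
    have h2 := congrArg (fun M => op M v) h1
    simp only [op_mul_apply] at h2
    change _ = act (A.prod k ℓ) _ at h2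
    rw [← act_inv_act (A.prod k ℓ) (op (X _) v), ← h2, ih, pow_succ', pow_succ, act_mul_apply,
      act_mul_apply]
    rfl

/-- With g the return map at k, X_{k−pℓ} = g⁻ᵖ X_k gᵖ. On the stable component gᵖ contracts, on the
image, which is unstable, g⁻ᵖ does not expand, and the unstable component is killed. The factor κ/2
absorbs the norm 1/κ of the projection to E^s. In particular X is not periodic. -/
theorem exists_contracting (hX : A.IsShearFamily X) (hA : A.Hyperbolic) {κ : ℝ} (hκ : 0 < κ)
    (hang : ∀ k, ∀ x ∈ A.stableSpace k, ∀ y ∈ A.unstableSpace k, κ * ‖x‖ ≤ ‖x + y‖) :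
    ∃ L : ℕ, 1 ≤ L ∧ ∀ k, ‖op (X (k - L))‖ ≤ ‖op (X k)‖ / 2 := by
  have h1 : ∀ᶠ p in atTop, ∀ k, ∀ x ∈ spectralSubspace (A.prod k ℓ) {z | ‖z‖ < 1},
      ‖act (A.prod k ℓ ^ p) x‖ ≤ κ / 2 * ‖x‖ :=
    A.eventually_forall_of_periodic
      (P := fun p g => ∀ x ∈ spectralSubspace g {z | ‖z‖ < 1}, ‖act (g ^ p) x‖ ≤ κ / 2 * ‖x‖)
      fun k => eventually_norm_le_mul_norm (f := fun p => act (A.prod k ℓ ^ p))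
        (fun x hx => tendsto_act_pow_of_mem_spectralSubspace hx) (by positivity)
  have h2 : ∀ᶠ p in atTop, ∀ k, ∀ x ∈ spectralSubspace (A.prod k ℓ) {z | 1 < ‖z‖},
      ‖act ((A.prod k ℓ)⁻¹ ^ p) x‖ ≤ 1 * ‖x‖ :=
    A.eventually_forall_of_periodic
      (P := fun p g => ∀ x ∈ spectralSubspace g {z | 1 < ‖z‖}, ‖act (g⁻¹ ^ p) x‖ ≤ 1 * ‖x‖)
      fun k => eventually_norm_le_mul_norm (f := fun p => act ((A.prod k ℓ)⁻¹ ^ p))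
        (fun x hx => tendsto_act_inv_pow_of_mem_spectralSubspace hx) one_pos
  obtain ⟨p, ⟨hp1, hp2⟩, hp⟩ := ((h1.and h2).and (eventually_ge_atTop 1)).exists
  refine ⟨p * ℓ, Nat.mul_pos hp A.one_le_period, fun k => ?_⟩
  refine ContinuousLinearMap.opNorm_le_bound _ (by positivity) fun v => ?_
  obtain ⟨x, hx, y, hy, rfl⟩ := Submodule.mem_sup.mp
    (show v ∈ A.stableSpace k ⊔ A.unstableSpace k by
      rw [stableSpace_sup_unstableSpace hA]; trivial)
  have hper : A.prod (k - (p * ℓ : ℕ)) ℓ = A.prod k ℓ := by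
    refine A.prod_congr ?_ ℓ
    rw [Nat.cast_mul]
    exact sub_mul_modEq _ _ _
  have hy0 : op (X (k - (p * ℓ : ℕ))) y = 0 := by
    refine hX.op_eq_zero _ y ?_
    rw [unstableSpace, hper]
    exact hy
  rw [map_add, hy0, add_zero, Nat.cast_mul, hX.op_sub_mul_period]
  calc _ ≤ 1 * ‖op (X k) (act (A.prod k ℓ ^ p) x)‖ := hp2 k _ (hX.op_mem k _)
    _ ≤ 1 * (‖op (X k)‖ * (κ / 2 * ‖x‖)) := by
      gcongr
      refine (ContinuousLinearMap.le_opNorm _ _).trans ?_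
      gcongr
      exact hp1 k x hx
    _ = ‖op (X k)‖ / 2 * (κ * ‖x‖) := by ring
    _ ≤ _ := by
      gcongr
      exact hang k x hx y hy

end IsShearFamily

end PeriodicCocycle

end Shear

/-! ### Construction of the path from a shear family -/

section Path

open Filter Topology

namespace PeriodicCocycle

/-- The representative of `k` modulo `ℓ` in `[w, w + ℓ)`. -/
def rep (w ℓ k : ℤ) : ℤ := w + (k - w) % ℓ

theorem rep_modEq (w ℓ k : ℤ) : rep w ℓ k ≡ k [ZMOD ℓ] := by
  simpa [rep] using (Int.mod_modEq (k - w) ℓ).add_left w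

theorem rep_congr (w : ℤ) {ℓ j k : ℤ} (h : j ≡ k [ZMOD ℓ]) : rep w ℓ j = rep w ℓ k := by
  rw [rep, rep, h.sub_right w]

theorem rep_of_mem {w ℓ k : ℤ} (h₁ : w ≤ k) (h₂ : k < w + ℓ) : rep w ℓ k = k := by
  rw [rep, Int.emod_eq_of_lt (by omega) (by omega)]
  ring

theorem le_rep {w ℓ : ℤ} (hℓ : 0 < ℓ) (k : ℤ) : w ≤ rep w ℓ k := by
  have := Int.emod_nonneg (k - w) hℓ.ne'
  rw [rep]
  omega

theorem rep_lt {w ℓ : ℤ} (hℓ : 0 < ℓ) (k : ℤ) : rep w ℓ k < w + ℓ := by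
  have := Int.emod_lt_of_pos (k - w) hℓ
  rw [rep]
  omega

theorem rep_succ {w ℓ : ℤ} (hℓ : 0 < ℓ) (k : ℤ) :
    rep w ℓ (k + 1) = rep w ℓ k + 1 ∨ rep w ℓ (k + 1) = w ∧ rep w ℓ k + 1 = w + ℓ := by
  have h1 := le_rep (w := w) hℓ k
  have h2 := rep_lt (w := w) hℓ k
  rw [rep_congr w ((rep_modEq w ℓ k).symm.add_right 1)]
  rcases lt_or_ge (rep w ℓ k + 1) (w + ℓ) with h | h
  · exact Or.inl (rep_of_mem (by omega) h)
  · have h3 : rep w ℓ k + 1 = w + ℓ := by omega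
    refine Or.inr ⟨?_, h3⟩
    rw [h3, rep_congr w (k := w) (by simp [Int.ModEq]), rep_of_mem le_rfl (by omega)]

theorem subspaceAngle_lt {ι : Type} [Fintype ι] {E F : Submodule ℝ (EuclideanSpace ℝ ι)}
    {u v : EuclideanSpace ℝ ι} (hu : u ∈ E) (hv : v ∈ F) (hu0 : u ≠ 0) (hv0 : v ≠ 0) {ε : ℝ}
    (hε : 0 < ε) (h : InnerProductGeometry.angle u v < ε) :
    subspaceAngle E F < ENNReal.ofReal ε := by
  refine lt_of_le_of_lt ?_ ((ENNReal.ofReal_lt_ofReal_iff hε).mpr h)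
  exact (iInf₂_le_of_le u hu (iInf₂_le_of_le v hv (iInf₂_le_of_le hu0 hv0 le_rfl)))

/-- The angle between the stable and unstable spaces is at least `arcsin κ` at every index. -/
def AngleBound {ι : Type} [Fintype ι] [DecidableEq ι] {G : Subgroup (GL ι ℝ)} {ℓ : ℕ}
    (A : PeriodicCocycle G ℓ) (κ : ℝ) : Prop :=
  ∀ k, ∀ x ∈ A.stableSpace k, ∀ y ∈ A.unstableSpace k, κ * ‖x‖ ≤ ‖x + y‖

/-- There is an `ε`-path of perturbations of `A`, through hyperbolic cocycles, to a cocycle whose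
stable and unstable spaces make an angle smaller than `ε` at some index. -/
def HasSmallAnglePath {ι : Type} [Fintype ι] [DecidableEq ι] {G : Subgroup (GL ι ℝ)} {ℓ : ℕ}
    (A : PeriodicCocycle G ℓ) (ε : ℝ) : Prop :=
  ∃ B : I → PeriodicCocycle G ℓ, A.IsPathOfPerturbations ε B ∧
    (∀ t, (B t).Hyperbolic) ∧
    ∃ j : ℤ, 1 ≤ j ∧ j ≤ ℓ ∧
      subspaceAngle ((B 1).stableSpace j) ((B 1).unstableSpace j) < ENNReal.ofReal ε

/-- Take a vector nearly realizing the norm of X_c and keep its stable component x. Its image x +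
aXx lies in the new stable space, while aXx stays in the unstable one and dominates x. In the
constant 8, a factor 2 pays for the near-maximizer and 4 for `angle_add_lt`; 1/κ bounds the
projection to E^s. -/
theorem IsShearFamily.exists_subspaceAngle_lt {ι : Type} [Fintype ι] [DecidableEq ι]
    {G : Subgroup (GL ι ℝ)} {ℓ : ℕ} {A : PeriodicCocycle G ℓ} {X : ℤ → Matrix ι ι ℝ}
    (hX : A.IsShearFamily X) (hA : A.Hyperbolic) {κ ε : ℝ} (hκ : 0 < κ) (hε : 0 < ε) (hε1 : ε ≤ 1)
    (hang : A.AngleBound κ) (H : ℤ → GL ι ℝ) (hH : ∀ k, H k ∈ G) (hp : ∀ k, H (k + ℓ) = H k)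
    {c : ℤ} {a : ℝ} (ha : |a| * ‖op (X c)‖ = 8 / ((1 - Real.cos ε) * κ))
    (hc : H c = shear (X c) (hX.sq_zero c) a) :
    subspaceAngle ((A.conj H hH hp).stableSpace c) ((A.conj H hH hp).unstableSpace c) <
      ENNReal.ofReal ε := by
  have hcos : 0 < 1 - Real.cos ε := by
    have hπ := Real.pi_gt_three
    rw [sub_pos, ← Real.cos_zero]
    exact Real.cos_lt_cos_of_nonneg_of_le_pi le_rfl (by linarith) hε
  have hb := norm_op_pos (hX.ne_zero c)
  obtain ⟨y₀, hy₀⟩ : ∃ y₀, ‖op (X c)‖ / 2 * ‖y₀‖ < ‖op (X c) y₀‖ := by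
    by_contra! hcon
    have := ContinuousLinearMap.opNorm_le_bound (op (X c)) (by positivity) hcon
    linarith
  obtain ⟨x, hx, z, hz, rfl⟩ := Submodule.mem_sup.mp
    (show y₀ ∈ A.stableSpace c ⊔ A.unstableSpace c by
      rw [stableSpace_sup_unstableSpace hA]; trivial)
  rw [map_add, hX.op_eq_zero c z hz, add_zero] at hy₀
  have h1 := hang c x hx z hz
  have ha0 : 0 < |a| := by
    have : 0 < |a| * ‖op (X c)‖ := by rw [ha]; positivity
    exact pos_of_mul_pos_left this hb.le
  have hpos : 0 < ‖op (X c) x‖ := lt_of_le_of_lt (by positivity) hy₀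
  have hy : a • op (X c) x ≠ 0 :=
    smul_ne_zero (abs_pos.mp ha0) (norm_pos_iff.mp hpos)
  have h2 : ‖x‖ ≤ (1 - Real.cos ε) / 4 * ‖a • op (X c) x‖ := by
    rw [norm_smul, Real.norm_eq_abs]
    calc ‖x‖ = (1 - Real.cos ε) / 4 * (8 / ((1 - Real.cos ε) * κ) / 2 * (κ * ‖x‖)) := by
          field_simp
          ring
      _ ≤ (1 - Real.cos ε) / 4 * (8 / ((1 - Real.cos ε) * κ) / 2 * ‖x + z‖) := by gcongr
      _ = (1 - Real.cos ε) / 4 * (|a| * (‖op (X c)‖ / 2 * ‖x + z‖)) := by rw [← ha]; ring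
      _ ≤ _ := by gcongr
  obtain ⟨h3, h4⟩ := angle_add_lt hε hε1 hy h2
  have h5 := A.act_mem_conj_stableSpace H hH hp hx
  rw [hc, act_shear_apply] at h5
  have h6 : a • op (X c) x ∈ A.unstableSpace c := Submodule.smul_mem _ _ (hX.op_mem c x)
  have h7 := A.act_mem_conj_unstableSpace H hH hp h6
  rw [hc, act_shear_apply, hX.op_eq_zero c _ h6, smul_zero, add_zero] at h7
  exact subspaceAngle_lt h5 h7 h3 hy hε h4

/-- The constants are chosen before the dimension, the group and the cocycle. The period 2m leaves
room for the support of the cutoff in one fundamental domain. -/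
theorem exists_hasSmallAnglePath {C ε κ δ : ℝ} (hC : 1 ≤ C) (hε : 0 < ε) (hε1 : ε ≤ 1)
    (hκ : 0 < κ) (hδ : 0 < δ) :
    ∃ T N : ℕ, 1 ≤ T ∧ 1 ≤ N ∧ ∀ {ι : Type} [Fintype ι] [DecidableEq ι] {G : Subgroup (GL ι ℝ)}
      {ℓ : ℕ} (A : PeriodicCocycle G ℓ), T ≤ ℓ → A.Hyperbolic → A.BoundedBy C → A.AngleBound κ →
      ∀ X : ℤ → Matrix ι ι ℝ, A.IsShearFamily X → ∀ (i : ℤ) (n : ℕ), N ≤ n →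
        δ * ‖op (X (i + n))‖ ≤ ‖op (X i)‖ → A.HasSmallAnglePath ε := by
  have hcos : 0 < 1 - Real.cos ε := by
    have hπ := Real.pi_gt_three
    rw [sub_pos, ← Real.cos_zero]
    exact Real.cos_lt_cos_of_nonneg_of_le_pi le_rfl (by linarith) hε
  have hQ : 0 < 8 / ((1 - Real.cos ε) * κ) := by positivity
  have hC0 : 0 < C := by linarith
  obtain ⟨m, N, hm, hN, hcut⟩ :=
    -- Multiplying by ‖A_k^{±1}‖ ≤ C leaves ε/2, hence a strict inequality.
    exists_cutoff hQ (show 0 < ε / (2 * C) by positivity) hδ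
  refine ⟨2 * m, N, by omega, hN, ?_⟩
  intro ι _ _ G ℓ A hTℓ hA hAC hang X hX i n hn hin
  obtain ⟨L, hL, hbL⟩ := hX.exists_contracting hA hκ hang
  have hb : ∀ k, 0 < ‖op (X k)‖ := fun k => norm_op_pos (hX.ne_zero k)
  obtain ⟨a, c, hac, had, ha0⟩ := hcut (fun k => ‖op (X k)‖) hb i n hn hin
    ⟨_, mul_sum_inv_le_of_contracting hb hL (one_le_pow₀ hC (n := 2)) hbL
      (hX.norm_le_succ hC0.le hAC) _⟩
  have hℓ : (0 : ℤ) < ℓ := by exact_mod_cast A.one_le_period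
  -- Since X is not periodic, the shears are defined on the window [w, w + ℓ) and repeated
  -- periodically. The scalars vanish at both ends w and w + ℓ, the latter because ℓ ≥ 2m, so the
  -- copies match at the seam.
  set w : ℤ := c - m with hw
  have haw : a w = 0 := ha0 w (by rw [hw]; simp)
  have haw' : a (w + ℓ) = 0 := ha0 _ (by
    rw [abs_of_nonneg (by omega)]
    omega)
  let K : ℤ → ℝ → GL ι ℝ := fun r t => shear (X r) (hX.sq_zero r) (t * a r)
  let H : ℝ → ℤ → GL ι ℝ := fun t k => K (rep w ℓ k) t
  have hH : ∀ t k, H t k ∈ G := fun t k => hX.shear_mem _ _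
  have hp : ∀ t k, H t (k + ℓ) = H t k := fun t k => by
    simp only [H]
    rw [rep_congr w (k := k) (by simp [Int.ModEq])]
  have hHs : ∀ t k, H t (k + 1) = K (rep w ℓ k + 1) t := by
    intro t k
    rcases rep_succ (w := w) hℓ k with h | ⟨h, h'⟩
    · simp only [H, h]
    · simp only [H, h, h', K, haw, haw', mul_zero, shear_zero]
  have hform : ∀ t k, H t (k + 1) * A.toFun k * (H t k)⁻¹ =
      shear (X (rep w ℓ k + 1)) (hX.sq_zero _) (t * (a (rep w ℓ k + 1) - a (rep w ℓ k))) *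
        A.toFun k := by
    intro t k
    rw [hHs]
    simp only [H, K]
    rw [← A.toFun_congr (rep_modEq w ℓ k), shear_inv, mul_assoc,
      mul_shear (hX.sq_zero _) (hX.sq_zero _) (hX.equivariant _), ← mul_assoc, ← shear_add]
    congr 2
    ring
  have hsmall : ∀ (t : I) k, |(t : ℝ) * (a (rep w ℓ k + 1) - a (rep w ℓ k))| *
      ‖op (X (rep w ℓ k + 1))‖ * C < ε := by
    intro t k
    have h1 : |(t : ℝ)| ≤ 1 := by rw [abs_of_nonneg t.2.1]; exact t.2.2
    calc _ ≤ 1 * |a (rep w ℓ k + 1) - a (rep w ℓ k)| * ‖op (X (rep w ℓ k + 1))‖ * C := by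
          rw [abs_mul]
          gcongr
      _ ≤ ε / (2 * C) * C := by
          rw [one_mul]
          gcongr
          exact had _
      _ = ε / 2 := by field_simp
      _ < ε := by linarith
  refine ⟨fun t => A.conj (H t) (hH t) (hp t), ⟨?_, ?_, ?_⟩, fun t => A.conj_hyperbolic _ _ _ hA,
    rep 1 ℓ c, le_rep hℓ c, ?_, ?_⟩
  · intro k
    have hK : ∀ r, Continuous fun t : I => K r t := fun r =>
      (continuous_shear _ _).comp (by fun_prop)
    exact ((hK _).mul continuous_const).mul (hK _).inv
  · intro k
    simp [conj, H, K, shear_zero]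
  · intro t k
    simp only [conj]
    rw [hform]
    refine max_lt (lt_of_le_of_lt (norm_act_sub_act_shear_mul_le _ _ _ _) ?_)
      (lt_of_le_of_lt (norm_act_inv_sub_act_inv_shear_mul_le _ _ _ _) ?_)
    · refine lt_of_le_of_lt ?_ (hsmall t k)
      gcongr
      exact (hAC.norm_le k).1
    · refine lt_of_le_of_lt ?_ (hsmall t k)
      gcongr
      exact (hAC.norm_le k).2
  · have := rep_lt (w := 1) hℓ c
    omega
  · rw [stableSpace, unstableSpace, prod_congr _ (rep_modEq 1 ℓ c)]
    refine hX.exists_subspaceAngle_lt hA hκ hε hε1 hang _ _ _ hac ?_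
    simp only [H, K]
    rw [rep_of_mem (by omega) (by omega)]
    simp

/-- A matrix `X` whose square is zero, given at the index `i`, extends to a shear family. -/
theorem exists_isShearFamily {ι : Type} [Fintype ι] [DecidableEq ι] {G : Subgroup (GL ι ℝ)}
    {ℓ : ℕ} (A : PeriodicCocycle G ℓ) (i : ℤ) (Y : Matrix ι ι ℝ) (hY : Y * Y = 0) (hY0 : Y ≠ 0)
    (hmem : ∀ v, op Y v ∈ A.unstableSpace i) (hzero : ∀ v ∈ A.unstableSpace i, op Y v = 0)
    (hG : ∀ a, shear Y hY a ∈ G) : ∃ X, A.IsShearFamily X ∧ X i = Y := by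
  obtain ⟨Ψ, hΨG, hΨ⟩ := A.exists_transport
  let Θ : ℤ → GL ι ℝ := fun k => Ψ k * (Ψ i)⁻¹
  have hΘi : Θ i = 1 := mul_inv_cancel _
  have hΘ : ∀ k, Θ (k + 1) = A.toFun k * Θ k := fun k => by simp only [Θ, hΨ, mul_assoc]
  have hΘG : ∀ k, Θ k ∈ G := fun k => G.mul_mem (hΨG k) (G.inv_mem (hΨG i))
  -- Pulled back by Θ, all return maps become the one at i; hence Θ_k carries the unstable space at
  -- i to the one at k.
  have hs : ∀ k, (Θ (k + 1))⁻¹ * A.prod (k + 1) ℓ * Θ (k + 1) =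
      (Θ k)⁻¹ * A.prod k ℓ * Θ k := by
    intro k
    have h1 : A.prod (k + 1) ℓ = A.toFun k * A.prod k ℓ * (A.toFun k)⁻¹ := by
      rw [A.toFun_mul_prod, mul_inv_cancel_right]
    rw [hΘ, h1]
    group
  have hc : ∀ k, (Θ k)⁻¹ * A.prod k ℓ * Θ k = A.prod i ℓ := by
    intro k
    induction k using Int.inductionOn' (b := i) with
    | zero => rw [hΘi]; group
    | succ k _ ih => rw [hs, ih]
    | pred k _ ih =>
      have := hs (k - 1)
      rw [sub_add_cancel] at this
      rw [← this, ih]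
  have hfwd : ∀ k, Θ k * A.prod i ℓ = A.prod k ℓ * Θ k := fun k => by rw [← hc k]; group
  have hbwd : ∀ k, (Θ k)⁻¹ * A.prod k ℓ = A.prod i ℓ * (Θ k)⁻¹ := fun k => by rw [← hc k]; group
  let X : ℤ → Matrix ι ι ℝ := fun k => (Θ k : Matrix ι ι ℝ) * Y * ((Θ k)⁻¹ : GL ι ℝ)
  have hop : ∀ k v, op (X k) v = act (Θ k) (op Y (act (Θ k)⁻¹ v)) := fun k v => by
    simp only [X, op_mul_apply]
    rfl
  have hsq : ∀ k, X k * X k = 0 := by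
    intro k
    have : X k * X k = (Θ k : Matrix ι ι ℝ) *
        (Y * (((Θ k)⁻¹ : GL ι ℝ) * (Θ k : Matrix ι ι ℝ)) * Y) *
        ((Θ k)⁻¹ : GL ι ℝ) := by simp only [X, mul_assoc]
    rw [this, Units.inv_mul, mul_one, hY, mul_zero, zero_mul]
  have hXY : ∀ k, X k * (Θ k : Matrix ι ι ℝ) = (Θ k : Matrix ι ι ℝ) * Y := fun k => by
    simp only [X]
    rw [mul_assoc, Units.inv_mul, mul_one]
  refine ⟨X, ⟨?_, hsq, ?_, ?_, ?_, ?_⟩, ?_⟩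
  · intro k
    simp only [X]
    rw [hΘ, mul_inv_rev]
    simp only [Units.val_mul, mul_assoc]
    rw [Units.inv_mul, mul_one]
  · intro k h0
    apply hY0
    have := hXY k
    rwa [h0, zero_mul, eq_comm, Units.mul_right_eq_zero] at this
  · intro k v
    rw [hop]
    exact act_mem_spectralSubspace (hfwd k) (hmem _)
  · intro k v hv
    rw [hop, hzero _ (act_mem_spectralSubspace (hbwd k) hv), map_zero]
  · intro k a
    have h1 : shear (X k) (hsq k) a = Θ k * shear Y hY a * (Θ k)⁻¹ := by
      rw [mul_shear hY (hsq k) (hXY k), mul_inv_cancel_right]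
    rw [h1]
    exact G.mul_mem (G.mul_mem (hΘG k) (hG a)) (G.inv_mem (hΘG k))
  · simp [X, hΘi]

end PeriodicCocycle

end Path

/-! ### Shear families from the absence of domination -/

section Groups

open Filter Topology

section RankOne

variable {ι : Type} [Fintype ι] [DecidableEq ι]

theorem op_vecMulVec (v q x : EuclideanSpace ℝ ι) :
    op (Matrix.vecMulVec v q) x = (inner ℝ q x) • v := by
  ext i
  simp [op, Matrix.ofLp_toEuclideanCLM, Matrix.vecMulVec_mulVec, PiLp.inner_apply, dotProduct,
    mul_comm]

theorem norm_op_vecMulVec_le (v q : EuclideanSpace ℝ ι) :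
    ‖op (Matrix.vecMulVec v q)‖ ≤ ‖v‖ * ‖q‖ := by
  refine ContinuousLinearMap.opNorm_le_bound _ (by positivity) fun x => ?_
  rw [op_vecMulVec, norm_smul]
  calc _ ≤ ‖q‖ * ‖x‖ * ‖v‖ := by gcongr; exact norm_inner_le_norm _ _
    _ = _ := by ring

theorem dotProduct_eq_inner {κ : Type} [Fintype κ] (q v : EuclideanSpace ℝ κ) :
    q.ofLp ⬝ᵥ v.ofLp = inner ℝ q v := by
  simp [PiLp.inner_apply, dotProduct, mul_comm]

theorem vecMulVec_mul_self {κ : Type} [Fintype κ] {v q : EuclideanSpace ℝ κ} (h : inner ℝ q v = 0) :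
    Matrix.vecMulVec v q * Matrix.vecMulVec v.ofLp q.ofLp = 0 := by
  rw [Matrix.vecMulVec_mul_vecMulVec, dotProduct_eq_inner, h]
  simp

theorem vecMulVec_ne_zero {v q : EuclideanSpace ℝ ι} (hv : v ≠ 0) (hq : q ≠ 0) :
    Matrix.vecMulVec v.ofLp q.ofLp ≠ 0 := by
  intro h
  have := op_vecMulVec v q q
  rw [h, op, map_zero] at this
  have h2 := this.symm
  simp [hv, hq] at h2

theorem shear_mem_specialLinear {v q : EuclideanSpace ℝ ι} (h : inner ℝ q v = 0) (a : ℝ) :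
    shear (Matrix.vecMulVec v.ofLp q.ofLp) (vecMulVec_mul_self h) a ∈ specialLinear ι := by
  rw [specialLinear, MonoidHom.mem_ker]
  ext1
  show Matrix.det (1 + a • Matrix.vecMulVec v.ofLp q.ofLp) = 1
  rw [← Matrix.smul_vecMulVec, Matrix.vecMulVec_eq Unit,
    Matrix.det_one_add_replicateCol_mul_replicateRow, dotProduct_smul, dotProduct_eq_inner, h]
  simp

end RankOne

namespace PeriodicCocycle

variable {ι : Type} [Fintype ι] [DecidableEq ι] {G : Subgroup (GL ι ℝ)} {ℓ : ℕ}

theorem HasSmallAnglePath.mono {A : PeriodicCocycle G ℓ} {ε ε' : ℝ} (h : ε ≤ ε')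
    (hA : A.HasSmallAnglePath ε) : A.HasSmallAnglePath ε' := by
  obtain ⟨B, hB, hh, j, h1, h2, h3⟩ := hA
  exact ⟨B, ⟨hB.continuous, hB.zero, fun t i => (hB.close t i).trans_le h⟩, hh, j, h1, h2,
    h3.trans_le (ENNReal.ofReal_le_ofReal h)⟩

/-- The first alternative is realized by the constant path, after moving the index into {1, …, ℓ}.
-/
theorem hasSmallAnglePath_or_angleBound {A : PeriodicCocycle G ℓ} (hA : A.Hyperbolic) {ε : ℝ}
    (hε : 0 < ε) (hε1 : ε ≤ 1) : A.HasSmallAnglePath ε ∨ A.AngleBound (Real.sin ε) := by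
  have hℓ : (0 : ℤ) < ℓ := by exact_mod_cast A.one_le_period
  by_cases h : ∃ k, subspaceAngle (A.stableSpace k) (A.unstableSpace k) < ENNReal.ofReal ε
  · left
    obtain ⟨k, hk⟩ := h
    refine ⟨fun _ => A, ⟨fun _ => continuous_const, fun _ => rfl, fun t i => by simpa using hε⟩,
      fun _ => hA, rep 1 ℓ k, le_rep hℓ k, ?_, ?_⟩
    · have := rep_lt (w := 1) hℓ k
      omega
    · rwa [stableSpace, unstableSpace, prod_congr _ (rep_modEq 1 ℓ k)]
  · right
    push Not at h
    intro k x hx y hy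
    refine sin_mul_norm_le_norm_add hε.le hε1 fun hx0 hy0 => ?_
    by_contra! hcon
    exact absurd (subspaceAngle_lt hx (Submodule.neg_mem _ hy) hx0 (neg_ne_zero.mpr hy0) hε hcon)
      (not_lt.mpr (h k))

theorem prod_mul_prod_period (A : PeriodicCocycle G ℓ) (k : ℤ) (n : ℕ) :
    A.prod k n * A.prod k ℓ = A.prod (k + n) ℓ * A.prod k n := by
  induction n with
  | zero => simp [prod]
  | succ n ih =>
    rw [prod, mul_assoc, ih, ← mul_assoc, toFun_mul_prod, mul_assoc, Nat.cast_succ, ← add_assoc]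

theorem prod_mem (A : PeriodicCocycle G ℓ) (k : ℤ) (n : ℕ) : A.prod k n ∈ G := by
  induction n with
  | zero => exact G.one_mem
  | succ n ih => exact G.mul_mem (A.mem _) ih

theorem act_prod_mem_stableSpace (A : PeriodicCocycle G ℓ) {k : ℤ} (n : ℕ)
    {v : EuclideanSpace ℝ ι} (hv : v ∈ A.stableSpace k) :
    act (A.prod k n) v ∈ A.stableSpace (k + n) :=
  act_mem_spectralSubspace (A.prod_mul_prod_period k n) hv

theorem act_prod_mem_unstableSpace (A : PeriodicCocycle G ℓ) {k : ℤ} (n : ℕ)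
    {v : EuclideanSpace ℝ ι} (hv : v ∈ A.unstableSpace k) :
    act (A.prod k n) v ∈ A.unstableSpace (k + n) :=
  act_mem_spectralSubspace (A.prod_mul_prod_period k n) hv

theorem act_prod_inv_mem_unstableSpace (A : PeriodicCocycle G ℓ) {k : ℤ} (n : ℕ)
    {v : EuclideanSpace ℝ ι} (hv : v ∈ A.unstableSpace (k + n)) :
    act (A.prod k n)⁻¹ v ∈ A.unstableSpace k :=
  act_mem_spectralSubspace (by
    rw [inv_mul_eq_iff_eq_mul, ← mul_assoc, prod_mul_prod_period, mul_inv_cancel_right]) hv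

theorem exists_of_not_isDominated {A : PeriodicCocycle G ℓ} {N : ℕ}
    (h : ¬ A.IsDominated A.stableSpace A.unstableSpace N) :
    ∃ (i : ℤ) (n : ℕ), N ≤ n ∧ ∃ u ∈ A.stableSpace i, ∃ v ∈ A.unstableSpace i,
      ‖u‖ = 1 ∧ ‖v‖ = 1 ∧ ‖act (A.prod i n) v‖ / 2 < ‖act (A.prod i n) u‖ := by
  simp only [IsDominated] at h
  push Not at h
  obtain ⟨i, n, hn, u, hu, v, hv, h1, h2, h3⟩ := h
  exact ⟨i, n, hn, u, hu, v, hv, h1, h2, h3⟩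

theorem IsShearFamily.act_prod_op {A : PeriodicCocycle G ℓ} {X : ℤ → Matrix ι ι ℝ}
    (hX : A.IsShearFamily X) (i : ℤ) (n : ℕ) (v : EuclideanSpace ℝ ι) :
    op (X (i + n)) (act (A.prod i n) v) = act (A.prod i n) (op (X i) v) := by
  have := congrArg (fun M => op M v) (hX.equivariant_prod i n)
  simp only [op_mul_apply] at this
  exact this

/-- In a group that contains all transvections, absence of domination gives a shear family whose
norm does not grow. -/
theorem exists_isShearFamily_of_transvections {A : PeriodicCocycle G ℓ}
    (hG : ∀ (v q : EuclideanSpace ℝ ι) (h : inner ℝ q v = 0) (a : ℝ),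
      shear (Matrix.vecMulVec v.ofLp q.ofLp) (vecMulVec_mul_self h) a ∈ G) {κ : ℝ} (hκ : 0 < κ)
    (hang : A.AngleBound κ) {N : ℕ} (h : ¬ A.IsDominated A.stableSpace A.unstableSpace N) :
    ∃ X, A.IsShearFamily X ∧ ∃ (i : ℤ) (n : ℕ), N ≤ n ∧
      κ / 2 * ‖op (X (i + n))‖ ≤ ‖op (X i)‖ := by
  obtain ⟨i, n, hn, u, hu, v, hv, hu1, hv1, huv⟩ := exists_of_not_isDominated h
  set g := A.prod i n with hg
  have hgu := A.act_prod_mem_stableSpace n hu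
  have hgv := A.act_prod_mem_unstableSpace n hv
  rw [← hg] at hgu hgv
  set F := A.unstableSpace (i + n) with hF
  set w := F.starProjection (act g u) with hw
  -- The covector must vanish on the unstable space at i + n and be nearly maximal on gu. The
  -- orthogonal component of gu does both, since the angle bound gives ‖q‖ ≥ κ‖gu‖.
  set q := act g u - w with hq
  have hwF : w ∈ F := Submodule.starProjection_apply_mem _ _
  have hqF : ∀ y ∈ F, inner ℝ q y = 0 := fun y hy =>
    Submodule.starProjection_inner_eq_zero _ y hy
  have hκq : κ * ‖act g u‖ ≤ ‖q‖ := by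
    rw [hq, sub_eq_add_neg]
    exact hang _ _ hgu _ (Submodule.neg_mem _ hwF)
  have hgu0 : 0 < ‖act g u‖ := lt_of_le_of_lt (by positivity) huv
  have hq0 : 0 < ‖q‖ := lt_of_lt_of_le (by positivity) hκq
  have hgv0 : act g v ≠ 0 := by
    intro h0
    have h1 := act_inv_act g v
    rw [h0, map_zero] at h1
    rw [← h1, norm_zero] at hv1
    exact zero_ne_one hv1
  have hqq : inner ℝ q (act g u) = ‖q‖ ^ 2 := by
    rw [← real_inner_self_eq_norm_sq, ← sub_eq_zero, ← inner_sub_right]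
    simp only [hq, sub_sub_cancel]
    exact hqF w hwF
  obtain ⟨X, hX, hXi⟩ := A.exists_isShearFamily (i + n)
    (Matrix.vecMulVec (act g v).ofLp q.ofLp) (vecMulVec_mul_self (hqF _ hgv))
    (vecMulVec_ne_zero hgv0 (norm_pos_iff.mp hq0))
    (fun y => by rw [op_vecMulVec]; exact Submodule.smul_mem _ _ hgv)
    (fun y hy => by rw [op_vecMulVec, hqF y hy, zero_smul])
    (hG _ _ (hqF _ hgv))
  refine ⟨X, hX, i, n, hn, ?_⟩
  -- Pulled back to i, the matrix sends u to a multiple of v: this is where the pair violating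
  -- domination enters.
  have h1 : op (X i) u = ‖q‖ ^ 2 • v := by
    have h2 := hX.act_prod_op i n u
    rw [hXi, ← hg, op_vecMulVec, hqq, ← map_smul] at h2
    rw [← act_inv_act g (op (X i) u), ← h2, act_inv_act]
  calc κ / 2 * ‖op (X (i + n))‖ ≤ κ / 2 * (‖act g v‖ * ‖q‖) := by
        rw [hXi]
        gcongr
        exact norm_op_vecMulVec_le _ _
    _ ≤ κ / 2 * (2 * ‖act g u‖ * ‖q‖) := by
        gcongr
        linarith
    _ = κ * ‖act g u‖ * ‖q‖ := by ring
    _ ≤ ‖q‖ * ‖q‖ := by gcongr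
    _ = ‖op (X i) u‖ := by
        rw [h1, norm_smul, hv1, mul_one, Real.norm_of_nonneg (by positivity), sq]
    _ ≤ ‖op (X i)‖ * ‖u‖ := ContinuousLinearMap.le_opNorm _ _
    _ = ‖op (X i)‖ := by rw [hu1, mul_one]

end PeriodicCocycle

/-! ### The symplectic group -/

section Symplectic

variable {d : ℕ}

/-- The operator of the standard complex structure; `⟪Jop v, w⟫` is the symplectic form. -/
abbrev Jop (d : ℕ) :
    EuclideanSpace ℝ (Fin d ⊕ Fin d) →L[ℝ] EuclideanSpace ℝ (Fin d ⊕ Fin d) :=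
  op (Matrix.J (Fin d) ℝ)

theorem inner_op_left (M : Matrix (Fin d ⊕ Fin d) (Fin d ⊕ Fin d) ℝ)
    (x y : EuclideanSpace ℝ (Fin d ⊕ Fin d)) :
    inner ℝ (op M x) y = inner ℝ x (op M.transpose y) := by
  simp only [← dotProduct_eq_inner, op, Matrix.ofLp_toEuclideanCLM]
  rw [Matrix.dotProduct_mulVec, Matrix.vecMul_transpose]

theorem inner_Jop_Jop (x y : EuclideanSpace ℝ (Fin d ⊕ Fin d)) :
    inner ℝ (Jop d x) (Jop d y) = inner ℝ x y := by
  rw [inner_op_left, ← op_mul_apply, Matrix.J_transpose, neg_mul, Matrix.J_squared, neg_neg, op,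
    map_one]
  rfl

theorem norm_Jop (x : EuclideanSpace ℝ (Fin d ⊕ Fin d)) : ‖Jop d x‖ = ‖x‖ := by
  rw [← sq_eq_sq₀ (norm_nonneg _) (norm_nonneg _), ← real_inner_self_eq_norm_sq,
    ← real_inner_self_eq_norm_sq, inner_Jop_Jop]

theorem inner_Jop_self (x : EuclideanSpace ℝ (Fin d ⊕ Fin d)) : inner ℝ (Jop d x) x = 0 := by
  have h := inner_op_left (Matrix.J (Fin d) ℝ) x x
  rw [Matrix.J_transpose, op, op, map_neg, neg_apply, inner_neg_right,
    real_inner_comm] at h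
  rw [real_inner_comm]
  linarith

theorem inner_Jop_act {g : GL (Fin d ⊕ Fin d) ℝ} (hg : g ∈ symplectic d)
    (x y : EuclideanSpace ℝ (Fin d ⊕ Fin d)) :
    inner ℝ (Jop d (act g x)) (act g y) = inner ℝ (Jop d x) y := by
  have h1 := SymplecticGroup.mem_iff'.mp hg
  have h2 : inner ℝ (Jop d (act g x)) (act g y) =
      inner ℝ (op ((g : Matrix _ _ ℝ).transpose * Matrix.J (Fin d) ℝ * (g : Matrix _ _ ℝ)) x)
        y := by
    rw [op_mul_apply, op_mul_apply, inner_op_left (Matrix.transpose _), Matrix.transpose_transpose]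
    rfl
  rw [h2, h1]

/-- The symplectic form is invariant, yet tends to 0 along the two orbits. Applied to g and to g⁻¹,
this makes the stable and unstable spaces isotropic. -/
theorem inner_Jop_eq_zero_of_tendsto {g : GL (Fin d ⊕ Fin d) ℝ} (hg : g ∈ symplectic d)
    {x y : EuclideanSpace ℝ (Fin d ⊕ Fin d)}
    (hx : Tendsto (fun p => act (g ^ p) x) atTop (𝓝 0))
    (hy : Tendsto (fun p => act (g ^ p) y) atTop (𝓝 0)) : inner ℝ (Jop d x) y = 0 := by
  have h1 : Tendsto (fun p => inner ℝ (Jop d (act (g ^ p) x)) (act (g ^ p) y)) atTop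
      (𝓝 (inner ℝ (Jop d 0) (0 : EuclideanSpace ℝ (Fin d ⊕ Fin d)))) :=
    (((Jop d).continuous.tendsto _).comp hx).inner hy
  simp only [inner_Jop_act ((symplectic d).pow_mem hg _), inner_zero_right] at h1
  exact tendsto_nhds_unique tendsto_const_nhds h1

theorem shear_mem_symplectic (v : EuclideanSpace ℝ (Fin d ⊕ Fin d)) (a : ℝ) :
    shear (Matrix.vecMulVec v.ofLp (Jop d v).ofLp) (vecMulVec_mul_self (inner_Jop_self v)) a ∈
      symplectic d := by
  refine SymplecticGroup.mem_iff'.mpr ?_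
  rw [shear_val]
  set X := Matrix.vecMulVec v.ofLp (Jop d v).ofLp with hX
  have hXX : X * X = 0 := vecMulVec_mul_self (inner_Jop_self v)
  have hXJ : X.transpose * Matrix.J (Fin d) ℝ = -(Matrix.J (Fin d) ℝ * X) := by
    rw [hX, Matrix.transpose_vecMulVec, Matrix.vecMulVec_mul, Matrix.mul_vecMulVec,
      ← Matrix.mulVec_transpose, Matrix.J_transpose, Matrix.neg_mulVec]
    simp only [Jop, op, Matrix.ofLp_toEuclideanCLM, Matrix.vecMulVec_neg]
  clear_value X
  rw [Matrix.transpose_add, Matrix.transpose_one, Matrix.transpose_smul, add_mul,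
    one_mul, smul_mul_assoc, hXJ, mul_add, mul_one, add_mul, mul_smul_comm, smul_mul_assoc,
    mul_smul_comm, neg_mul, mul_assoc, hXX]
  simp

namespace PeriodicCocycle

/-- The transvection t ⊗ Jt is symplectic and, E^u being isotropic, vanishes on E^u when t is
unstable. Its norm is ‖t‖² at i and at most ‖gt‖² at i + n, so an unstable t that g expands at most
2M times is enough. -/
theorem exists_isShearFamily_of_symplectic {ℓ : ℕ} {A : PeriodicCocycle (symplectic d) ℓ}
    (hA : A.Hyperbolic) {κ : ℝ} (hκ : 0 < κ) (hang : A.AngleBound κ) {N : ℕ}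
    (h : ¬ A.IsDominated A.stableSpace A.unstableSpace N) :
    ∃ X, A.IsShearFamily X ∧ ∃ (i : ℤ) (n : ℕ), N ≤ n ∧
      (2 * (1 + κ⁻¹))⁻¹ ^ 2 * ‖op (X (i + n))‖ ≤ ‖op (X i)‖ := by
  obtain ⟨i, n, hn, u, hu, v, hv, hu1, hv1, huv⟩ := exists_of_not_isDominated h
  set g := A.prod i n with hg
  set M := 1 + κ⁻¹ with hM
  have hM1 : 1 ≤ M := by have := inv_pos.mpr hκ; linarith
  -- If ‖gv‖ ≤ 1, take v. Otherwise ‖gu‖ > 1/2, and the unstable part t of J(gu) is used: by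
  -- isotropy of E^s its pairing with gu is ‖gu‖², and invariance of the form gives ‖g⁻¹t‖ ≥ ‖gu‖²,
  -- whereas ‖t‖ ≤ M‖gu‖.
  obtain ⟨t, ht, ht0, htM⟩ : ∃ t ∈ A.unstableSpace i, t ≠ 0 ∧ ‖act g t‖ ≤ 2 * M * ‖t‖ := by
    rcases le_or_gt ‖act g v‖ 1 with hle | hgt
    · exact ⟨v, hv, by rintro rfl; simp at hv1, by rw [hv1]; linarith⟩
    · have hgu := A.act_prod_mem_stableSpace n hu
      rw [← hg] at hgu
      obtain ⟨s, hs, t, ht, hst⟩ := Submodule.mem_sup.mp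
        (show Jop d (act g u) ∈ A.stableSpace (i + n) ⊔ A.unstableSpace (i + n) by
          rw [stableSpace_sup_unstableSpace hA]; trivial)
      have h1 := hang _ s hs t ht
      rw [hst, norm_Jop] at h1
      have h2 : ‖t‖ ≤ M * ‖act g u‖ := by
        have h3 : t = Jop d (act g u) - s := by rw [← hst]; abel
        have h4 : ‖s‖ ≤ κ⁻¹ * ‖act g u‖ := by
          rw [inv_mul_eq_div, le_div_iff₀ hκ]; linarith
        calc ‖t‖ ≤ ‖Jop d (act g u)‖ + ‖s‖ := by rw [h3]; exact norm_sub_le _ _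
          _ ≤ ‖act g u‖ + κ⁻¹ * ‖act g u‖ := by rw [norm_Jop]; gcongr
          _ = _ := by rw [hM]; ring
      have h5 : ‖act g u‖ ^ 2 = inner ℝ (Jop d u) (act g⁻¹ t) := by
        rw [← inner_Jop_act (A.prod_mem i n) u, ← hg, act_act_inv, ← real_inner_self_eq_norm_sq,
          ← inner_Jop_Jop]
        conv_lhs => rw [← hst]
        rw [inner_add_right, hst, inner_Jop_eq_zero_of_tendsto (A.prod_mem (i + n) ℓ)
          (tendsto_act_pow_of_mem_spectralSubspace hgu)
          (tendsto_act_pow_of_mem_spectralSubspace hs), zero_add]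
      have h6 : ‖act g u‖ ^ 2 ≤ ‖act g⁻¹ t‖ := by
        rw [h5]
        refine (real_inner_le_norm _ _).trans ?_
        rw [norm_Jop, hu1, one_mul]
      have h7 : 1 / 2 < ‖act g u‖ := by linarith
      refine ⟨act g⁻¹ t, A.act_prod_inv_mem_unstableSpace n ht, ?_, ?_⟩
      · rw [← norm_pos_iff]
        exact lt_of_lt_of_le (by positivity) h6
      · rw [act_act_inv]
        calc ‖t‖ ≤ M * ‖act g u‖ := h2
          _ ≤ M * (2 * ‖act g u‖ ^ 2) := by gcongr; nlinarith
          _ ≤ M * (2 * ‖act g⁻¹ t‖) := by gcongr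
          _ = _ := by ring
  have ht1 : 0 < ‖t‖ := norm_pos_iff.mpr ht0
  have hJt : Jop d t ≠ 0 := by rw [← norm_pos_iff, norm_Jop]; exact ht1
  have hiso : ∀ y ∈ A.unstableSpace i, inner ℝ (Jop d t) y = 0 := fun y hy =>
    inner_Jop_eq_zero_of_tendsto ((symplectic d).inv_mem (A.prod_mem i ℓ))
      (tendsto_act_inv_pow_of_mem_spectralSubspace ht)
      (tendsto_act_inv_pow_of_mem_spectralSubspace hy)
  obtain ⟨X, hX, hXi⟩ := A.exists_isShearFamily i
    (Matrix.vecMulVec t.ofLp (Jop d t).ofLp) (vecMulVec_mul_self (inner_Jop_self t))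
    (vecMulVec_ne_zero ht0 hJt)
    (fun y => by rw [op_vecMulVec]; exact Submodule.smul_mem _ _ ht)
    (fun y hy => by rw [op_vecMulVec, hiso y hy, zero_smul])
    (shear_mem_symplectic t)
  refine ⟨X, hX, i, n, hn, ?_⟩
  have h1 : ‖op (X (i + n))‖ ≤ ‖act g t‖ ^ 2 := by
    refine ContinuousLinearMap.opNorm_le_bound _ (by positivity) fun y => ?_
    rw [← act_act_inv g y, hg, hX.act_prod_op i n, ← hg, hXi, op_vecMulVec, map_smul, norm_smul,
      ← inner_Jop_act (A.prod_mem i n), ← hg, act_act_inv]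
    calc _ ≤ ‖Jop d (act g t)‖ * ‖y‖ * ‖act g t‖ := by gcongr; exact norm_inner_le_norm _ _
      _ = _ := by rw [norm_Jop]; ring
  have h2 : ‖t‖ ^ 2 ≤ ‖op (X i)‖ := by
    have h3 := ContinuousLinearMap.le_opNorm (op (X i)) (Jop d t)
    rw [hXi, op_vecMulVec, norm_smul, real_inner_self_eq_norm_sq, norm_Jop,
      Real.norm_of_nonneg (by positivity)] at h3
    rw [hXi]
    exact le_of_mul_le_mul_right h3 ht1
  calc (2 * M)⁻¹ ^ 2 * ‖op (X (i + n))‖ ≤ (2 * M)⁻¹ ^ 2 * (2 * M * ‖t‖) ^ 2 := by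
        gcongr
        refine h1.trans ?_
        gcongr
    _ = ‖t‖ ^ 2 := by
        have : M ≠ 0 := by positivity
        field_simp
    _ ≤ _ := h2

end PeriodicCocycle

end Symplectic

/-- The constants of the small angle property, uniform over all groups in which absence of
domination produces shear families of controlled norm. -/
theorem exists_smallAngleProperty {C ε δ : ℝ} (hC : 1 ≤ C) (hε : 0 < ε) (hε1 : ε ≤ 1)
    (hδ : 0 < δ) :
    ∃ T N : ℕ, 1 ≤ T ∧ 1 ≤ N ∧ ∀ {ι : Type} [Fintype ι] [DecidableEq ι] (G : Subgroup (GL ι ℝ)),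
      (∀ (ℓ : ℕ) (A : PeriodicCocycle G ℓ), A.Hyperbolic → A.AngleBound (Real.sin ε) →
        ¬ A.IsDominated A.stableSpace A.unstableSpace N →
        ∃ X, A.IsShearFamily X ∧ ∃ (i : ℤ) (n : ℕ), N ≤ n ∧
          δ * ‖op (X (i + n))‖ ≤ ‖op (X i)‖) →
      ∀ ε', ε ≤ ε' → SmallAngleProperty G C ε' T N := by
  have hκ : 0 < Real.sin ε :=
    Real.sin_pos_of_pos_of_lt_pi hε (by have := Real.pi_gt_three; linarith)
  obtain ⟨T, N, hT, hN, h⟩ := PeriodicCocycle.exists_hasSmallAnglePath hC hε hε1 hκ hδ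
  refine ⟨T, N, hT, hN, fun G hG ε' hε' ℓ A hTℓ hA hAC hdom => ?_⟩
  refine PeriodicCocycle.HasSmallAnglePath.mono hε' ?_
  rcases PeriodicCocycle.hasSmallAnglePath_or_angleBound hA hε hε1 with h1 | hang
  · exact h1
  · obtain ⟨X, hX, i, n, hn, hin⟩ := hG ℓ A hA hang hdom
    exact h A hTℓ hA hAC hang X hX i n hn hin

end Groups

end LinearCocycle

end

theorem mainTheorem6 (d₀ : ℕ) (hd₀ : 1 ≤ d₀) (C : ℝ) (hC : 1 < C) (ε : ℝ) (hε : 0 < ε) :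
    ∃ T N : ℕ, 1 ≤ T ∧ 1 ≤ N ∧
      LinearCocycle.SmallAngleProperty (⊤ : Subgroup (GL (Fin d₀) ℝ)) C ε T N ∧
      LinearCocycle.SmallAngleProperty (LinearCocycle.specialLinear (Fin d₀)) C ε T N ∧
      (∀ d : ℕ, d₀ = 2 * d →
        LinearCocycle.SmallAngleProperty (LinearCocycle.symplectic d) C ε T N) := by
  set ε₁ := min ε 1
  have hε₁ : 0 < ε₁ := lt_min hε one_pos
  have hε₁1 : ε₁ ≤ 1 := min_le_right _ _
  set κ := Real.sin ε₁
  have hκ : 0 < κ :=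
    Real.sin_pos_of_pos_of_lt_pi hε₁ (by have := Real.pi_gt_three; linarith)
  -- The smaller of the transvection and symplectic bounds, so that the same T and N serve the three
  -- groups.
  have hδ : 0 < min (κ / 2) ((2 * (1 + κ⁻¹))⁻¹ ^ 2) := by
    have := inv_pos.mpr hκ
    exact lt_min (by positivity) (by positivity)
  obtain ⟨T, N, hT, hN, h⟩ := LinearCocycle.exists_smallAngleProperty hC.le hε₁ hε₁1 hδ
  refine ⟨T, N, hT, hN, ?_, ?_, fun d _ => ?_⟩
  · refine h _ (fun ℓ A _ hang hdom => ?_) ε (min_le_left _ _)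
    obtain ⟨X, hX, i, n, hn, hin⟩ :=
      LinearCocycle.PeriodicCocycle.exists_isShearFamily_of_transvections
        (fun _ _ _ _ => Subgroup.mem_top _) hκ hang hdom
    exact ⟨X, hX, i, n, hn,
      (mul_le_mul_of_nonneg_right (min_le_left _ _) (norm_nonneg _)).trans hin⟩
  · refine h _ (fun ℓ A _ hang hdom => ?_) ε (min_le_left _ _)
    obtain ⟨X, hX, i, n, hn, hin⟩ :=
      LinearCocycle.PeriodicCocycle.exists_isShearFamily_of_transvections
        (fun _ _ hqv a => LinearCocycle.shear_mem_specialLinear hqv a) hκ hang hdom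
    exact ⟨X, hX, i, n, hn,
      (mul_le_mul_of_nonneg_right (min_le_left _ _) (norm_nonneg _)).trans hin⟩
  · refine h _ (fun ℓ A hA hang hdom => ?_) ε (min_le_left _ _)
    obtain ⟨X, hX, i, n, hn, hin⟩ :=
      LinearCocycle.PeriodicCocycle.exists_isShearFamily_of_symplectic hA hκ hang hdom
    exact ⟨X, hX, i, n, hn,
      (mul_le_mul_of_nonneg_right (min_le_right _ _) (norm_nonneg _)).trans hin⟩
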